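/- For a finite abelian group $G$ and $f\colon G\to\mathbb C$ let $\partial_h f(n)=f(n)\overline{f(n-h)}$, and let $\|f\|_{U^s}\ge 0$ be the Gowers uniformity norm, defined by $\|f\|_{U^s}^{2^s}=\mathbb E_{n,h_1,\dots,h_s\in G}\,\partial_{h_1}\cdots\partial_{h_s}f(n)$. For integers $\mathbf a=(a_1<\dots<a_k)$ and $A\subseteq\mathbb Z/N\mathbb Z$ let $\Lambda_{\mathbf a}(1_A)=\mathbb E_{n,d\in\mathbb Z/N\mathbb Z}\,1_A(n+a_1d)\cdots 1_A(n+a_kd)$. For $k\ge 4$ and $0<\alpha<1$ let $\rho_{\mathbf a}(\alpha)$ be the largest real number $\rho$ such that for every $\varepsilon>0$ there exist $\eta>0$ and $N_0$ so that, whenever $N\ge N_0$ and $A\subseteq\mathbb Z/N\mathbb Z$ satisfies $\|1_A-\alpha\|_{U^{k-2}}\le\eta$, one has $\Lambda_{\mathbf a}(1_A)\ge\rho-\varepsilon$. Call $\mathbf a$ symmetric if $k$ is even and $a_1+a_k=a_2+a_{k-1}=a_3+a_{k-2}=\cdots$. Theorem. Let $k\ge 4$, let $\mathbf a=(a_1<\dots<a_k)$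 be integers, and suppose that either $k$ is odd or $\mathbf a$ is not symmetric. Then there is a constant $c>0$, depending only on $\mathbf a$, such that for all $0<\alpha<1/2$ the number $\rho_{\mathbf a}(\alpha)$ exists (the largest such $\rho$ is attained) and $$\rho_{\mathbf a}(\alpha)<\alpha^{c\log(1/\alpha)}.$$ -/

import Mathlib

open scoped BigOperators ComplexConjugate

noncomputable section

namespace PatternAP

/-- The pattern count `Λ_a(f₁, …, f_k) = 𝔼_{n,d} f₁(n + a₁ d) ⋯ f_k(n + a_k d)`
over a finite abelian group. -/
def patternAvg {G : Type*} [AddCommGroup G] [Fintype G] {k : ℕ} (a : Fin k → ℤ)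
    (f : Fin k → G → ℝ) : ℝ :=
  𝔼 n : G, 𝔼 d : G, ∏ i, f i (n + a i • d)

/-- The density `Λ_a(1_A)` of `a`-APs in `A`. -/
def patternDensity {G : Type*} [AddCommGroup G] [Fintype G] {k : ℕ} (a : Fin k → ℤ)
    (A : Set G) : ℝ :=
  patternAvg a (fun _ => A.indicator 1)

/-- The multiplicative derivative `∂_h f(n) = f(n) · conj (f(n - h))`. -/
def mulDeriv {G : Type*} [AddCommGroup G] (h : G) (f : G → ℂ) : G → ℂ :=
  fun n => f n * conj (f (n - h))

/-- The Gowers average `𝔼_{n, h₁, …, h_k} ∂_{h₁} ⋯ ∂_{h_k} f(n)`. -/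
def gowersAvg {G : Type*} [AddCommGroup G] [Fintype G] (k : ℕ) (f : G → ℂ) : ℂ :=
  𝔼 h : Fin k → G, 𝔼 n : G, (List.ofFn h).foldr mulDeriv f n

/-- The Gowers uniformity norm `‖f‖_{U^k}`, the nonnegative real whose `2^k`-th power is the
Gowers average (which is real and nonnegative for `k ≥ 1`, see `gowersNorm_pow`). -/
def gowersNorm {G : Type*} [AddCommGroup G] [Fintype G] (k : ℕ) (f : G → ℂ) : ℝ :=
  ‖gowersAvg k f‖ ^ ((2 ^ k : ℝ)⁻¹)

theorem expect_mulDeriv {G : Type*} [AddCommGroup G] [Fintype G] (g : G → ℂ) :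
    𝔼 h : G, 𝔼 n : G, mulDeriv h g n = ((‖𝔼 n : G, g n‖ ^ 2 : ℝ) : ℂ) := by
  rw [Finset.expect_comm]
  have h1 : ∀ n : G, 𝔼 h : G, mulDeriv h g n = g n * conj (𝔼 m : G, g m) := by
    intro n
    unfold mulDeriv
    rw [← Finset.mul_expect, map_expect]
    congr 1
    exact Fintype.expect_equiv (Equiv.subLeft n) _ _ (fun _ => rfl)
  simp_rw [h1]
  rw [← Finset.expect_mul, Complex.mul_conj, Complex.normSq_eq_norm_sq]

theorem gowersAvg_succ {G : Type*} [AddCommGroup G] [Fintype G] (k : ℕ) (f : G → ℂ) :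
    gowersAvg (k + 1) f =
      ((𝔼 h : Fin k → G, ‖𝔼 n : G, (List.ofFn h).foldr mulDeriv f n‖ ^ 2 : ℝ) : ℂ) := by
  have h1 : gowersAvg (k + 1) f = 𝔼 p : G × (Fin k → G), 𝔼 n : G,
      mulDeriv p.1 ((List.ofFn p.2).foldr mulDeriv f) n := by
    unfold gowersAvg
    refine (Fintype.expect_equiv (Fin.consEquiv (fun _ => G)) _ _ ?_).symm
    intro p
    simp [Fin.consEquiv, List.ofFn_succ]
  rw [h1, ← Finset.univ_product_univ, Finset.expect_product, Finset.expect_comm]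
  simp_rw [expect_mulDeriv]
  exact (Complex.ofReal_expect _ _).symm

theorem gowersNorm_pow {G : Type*} [AddCommGroup G] [Fintype G] (k : ℕ) (f : G → ℂ) :
    ((gowersNorm (k + 1) f ^ 2 ^ (k + 1) : ℝ) : ℂ) = gowersAvg (k + 1) f := by
  have h2 : gowersNorm (k + 1) f ^ 2 ^ (k + 1) = ‖gowersAvg (k + 1) f‖ := by
    unfold gowersNorm
    have := Real.rpow_inv_natCast_pow (norm_nonneg (gowersAvg (k + 1) f))
      (n := 2 ^ (k + 1)) (by positivity)
    push_cast at this
    exact this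
  rw [h2, gowersAvg_succ, Complex.norm_real, Real.norm_of_nonneg]
  exact Finset.expect_nonneg (fun _ _ => by positivity)

/-- The real numbers `ρ` such that for every `ε > 0` there are `η > 0` and `N₀` so that, for all
`N ≥ N₀`, every `A ⊆ ℤ/Nℤ` with `‖1_A - α‖_{U^{k-2}} ≤ η` has `Λ_a(1_A) ≥ ρ - ε`. -/
def lowerBounds {k : ℕ} (a : Fin k → ℤ) (α : ℝ) : Set ℝ :=
  {ρ | ∀ ε : ℝ, 0 < ε → ∃ η : ℝ, 0 < η ∧ ∃ N₀ : ℕ, ∀ (N : ℕ) [NeZero N], N₀ ≤ N →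
    ∀ A : Set (ZMod N),
      gowersNorm (k - 2) (fun n => A.indicator (1 : ZMod N → ℂ) n - (α : ℂ)) ≤ η →
      ρ - ε ≤ patternDensity a A}

/-- `ρ_a(α)`: the largest element of `lowerBounds a α`. -/
def rho {k : ℕ} (a : Fin k → ℤ) (α : ℝ) : ℝ :=
  sSup (lowerBounds a α)

/-- `a = (a₁, …, a_k)` is symmetric if `k` is even and `a₁ + a_k = a₂ + a_{k-1} = ⋯`. -/
def IsSymmetric {k : ℕ} (a : Fin k → ℤ) : Prop :=
  Even k ∧ ∀ i j : Fin k, a i + a i.rev = a j + a j.rev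

end PatternAP

end

/-! The sets that give the upper bound are built for prime `N`. Colour the circle, and put `n` into
`A` when `n ^ (k - 2)` lies in an interval of length about `α N` whose position is dictated by the
colour of `n / N`; this is a `phaseSet`. It must be uniform and contain few patterns.

Uniformity holds for every colouring by boundedly many arcs. Up to `O(1 / N)`, Fourier expansion
writes `1_A - α` as a combination of phases of degree exactly `k - 2`, with coefficients of total
size `O((log N) ^ 2)`. Such a phase correlates with a dual function of order `k - 2` by at most a
negative power of `N`: Cauchy–Schwarz reduces the correlation to iterated derivatives
(`norm_expect_mul_dual_le`), and differencing a phase leaves a nontrivial linear one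
(`derivMean_phase_le`).

For the patterns, take integer weights `W` annihilating polynomials of degree at most `k - 2` on the
nodes `a`. They annihilate the values `(n + a i • d) ^ (k - 2)`, so the interval positions satisfy a
linear relation up to a small error, and spacing the positions makes the relation exact. By
`exists_code` the positions can be chosen so that every colour class of a pattern in `A` then has
total weight zero. The price is that `α` is at most a fixed negative power of the number of colours.

The colouring, in the spirit of Behrend, uses the points `M ^ j * x` for `j < r`. Coarse positions
and halves of the circle ensure that the scaled progressions have short steps and do not wrap
around; this uses that no proper initial segment has weight zero, by Rolle's theorem. The squared
length of the coordinate vector is then a quadratic in `a i`. Its rounded value is part of the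
colour, and no colour occurs once, so a large leading coefficient would pair the nodes with constant
sums and make `a` symmetric (`quadratic_coeff_le`). Hence all steps are tiny, and the powers of `M`
confine the common difference to a proportion `M ^ (-r)`.

The fine scale is recorded once and not for each coordinate. With `M = 2 ^ r` there are thus only `C
^ r` colours, so density `α = D ^ (-r)` is allowed while the pattern density is at most `2 ^ (-r ^
2)`. -/

noncomputable section

namespace PatternAP

/-! ### Divided difference weights -/

section Weights

open Polynomial

/-- `W` is a nowhere vanishing integer multiple of the divided difference functional at the
nodes `a`. -/
structure IsWeight {k : ℕ} (a W : Fin k → ℤ) : Prop where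
  ne_zero : ∀ i, W i ≠ 0
  sum_eval : ∀ p : ℝ[X], p.degree < (k - 1 : ℕ) → ∑ i, (W i : ℝ) * p.eval (a i : ℝ) = 0
  exists_interp : ∀ v : Fin k → ℝ, ∑ i, (W i : ℝ) * v i = 0 →
    ∃ p : ℝ[X], p.degree < (k - 1 : ℕ) ∧ ∀ i, p.eval (a i : ℝ) = v i

/-- Lagrange interpolation expresses the coefficient of degree `k - 1` as a combination of the
values with coefficients `1 / D i`; multiplying by the product of all `D i` makes them integers.
Values of weighted sum zero therefore have an interpolant without that coefficient. -/
theorem exists_isWeight {k : ℕ} (hk : 1 ≤ k) {a : Fin k → ℤ} (ha : StrictMono a) :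
    ∃ W : Fin k → ℤ, IsWeight a W := by
  classical
  set D : Fin k → ℤ := fun i => ∏ j ∈ Finset.univ.erase i, (a i - a j) with hD
  have hD0 : ∀ i, D i ≠ 0 := fun i => Finset.prod_ne_zero_iff.2 fun j hj =>
    sub_ne_zero.2 fun h => (Finset.ne_of_mem_erase hj) (ha.injective h).symm
  have hDR : ∀ i, (D i : ℝ) = ∏ j ∈ Finset.univ.erase i, ((a i : ℝ) - (a j : ℝ)) := by
    intro i; simp [hD]
  have hD0R : ∀ i, (D i : ℝ) ≠ 0 := fun i => by exact_mod_cast hD0 i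
  have hinj : Set.InjOn (fun i => (a i : ℝ)) (Finset.univ : Finset (Fin k)) :=
    fun i _ j _ h => ha.injective (Int.cast_injective h)
  have hWR : ∀ i, ((∏ i' ∈ Finset.univ.erase i, D i' : ℤ) : ℝ)
      = (∏ i', (D i' : ℝ)) / (D i : ℝ) := by
    intro i
    rw [eq_div_iff (hD0R i), ← Finset.prod_erase_mul Finset.univ _ (Finset.mem_univ i)]
    push_cast
    rfl
  have hprod : (∏ i', (D i' : ℝ)) ≠ 0 := Finset.prod_ne_zero_iff.2 fun i _ => hD0R i
  have key : ∀ p : ℝ[X], p.degree < k → ∑ i, ((∏ i' ∈ Finset.univ.erase i, D i' : ℤ) : ℝ)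
      * p.eval (a i : ℝ) = (∏ i', (D i' : ℝ)) * p.coeff (k - 1) := by
    intro p hp
    have h := Lagrange.coeff_eq_sum hinj (P := p) (by simpa using hp)
    rw [Finset.card_univ, Fintype.card_fin] at h
    rw [h, Finset.mul_sum]
    refine Finset.sum_congr rfl fun i _ => ?_
    rw [hWR, ← hDR]
    ring
  refine ⟨fun i => ∏ i' ∈ Finset.univ.erase i, D i',
    fun i => Finset.prod_ne_zero_iff.2 fun j _ => hD0 j, ?_, ?_⟩
  · intro p hp
    rw [key p (hp.trans_le (by exact_mod_cast Nat.sub_le k 1)),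
      coeff_eq_zero_of_degree_lt hp, mul_zero]
  · intro v hv
    set p := Lagrange.interpolate Finset.univ (fun i => (a i : ℝ)) v with hp
    have hpv : ∀ i, p.eval (a i : ℝ) = v i := fun i =>
      Lagrange.eval_interpolate_at_node v hinj (Finset.mem_univ i)
    have hdeg : p.degree < k := by
      have := Lagrange.degree_interpolate_lt v hinj
      rwa [Finset.card_univ, Fintype.card_fin] at this
    have h0 := key p hdeg
    simp_rw [hpv] at h0
    rw [hv] at h0
    have hc : p.coeff (k - 1) = 0 := by
      rcases mul_eq_zero.1 h0.symm with h | h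
      · exact absurd h hprod
      · exact h
    refine ⟨p, ?_, hpv⟩
    rw [degree_lt_iff_coeff_zero]
    intro m hm
    rcases hm.eq_or_lt with h | h
    · rwa [← h]
    · exact coeff_eq_zero_of_degree_lt (hdeg.trans_le (by exact_mod_cast (by omega : k ≤ m)))

/-- The partial sums of a divided difference functional do not vanish. -/
theorem IsWeight.sum_lt_ne_zero {k : ℕ} {a W : Fin k → ℤ} (hW : IsWeight a W)
    (ha : StrictMono a) {t : ℕ} (ht : 0 < t) (htk : t < k) :
    ∑ i : Fin k, (W i : ℝ) * (if (i : ℕ) < t then 1 else 0) ≠ 0 := by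
  classical
  intro h0
  obtain ⟨p, hdeg, hp⟩ := hW.exists_interp _ h0
  -- `p` interpolates a step function, so Rolle's theorem applies in every gap except the one where
  -- the step occurs.
  have hroll : ∀ i : Fin (k - 1), (i : ℕ) + 1 ≠ t →
      ∃ x ∈ Set.Ioo (a ⟨i, by omega⟩ : ℝ) (a ⟨i + 1, by omega⟩ : ℝ),
        p.derivative.eval x = 0 := by
    intro i hi
    have hlt : (a ⟨i, by omega⟩ : ℝ) < (a ⟨i + 1, by omega⟩ : ℝ) := by
      exact_mod_cast ha (by simp [Fin.lt_def])
    refine exists_hasDerivAt_eq_zero hlt p.continuous.continuousOn ?_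
      fun x _ => p.hasDerivAt x
    rw [hp, hp]
    have : ((i : ℕ) < t) ↔ ((i : ℕ) + 1 < t) := by omega
    simp [this]
  choose! x hx hx0 using hroll
  -- There are `k - 2` distinct zeros, but the degree of the derivative is at most `k - 3`.
  have hder : p.derivative = 0 := by
    refine Polynomial.eq_zero_of_natDegree_lt_card_of_eval_eq_zero' p.derivative
      ((Finset.univ.filter fun i : Fin (k - 1) => (i : ℕ) + 1 ≠ t).image x) ?_ ?_
    · intro y hy
      obtain ⟨i, hi, rfl⟩ := Finset.mem_image.1 hy
      exact hx0 i (Finset.mem_filter.1 hi).2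
    · rw [Finset.card_image_of_injOn]
      · have hc : (Finset.univ.filter fun i : Fin (k - 1) => (i : ℕ) + 1 ≠ t)
            = Finset.univ.erase ⟨t - 1, by omega⟩ := by
          ext i
          simp only [Finset.mem_filter, Finset.mem_univ, true_and, Finset.mem_erase, and_true,
            ne_eq, Fin.ext_iff]
          omega
        rw [hc, Finset.card_erase_of_mem (Finset.mem_univ _), Finset.card_univ, Fintype.card_fin]
        have hpn : p ≠ 0 := by
          rintro rfl
          have := hp ⟨0, by omega⟩
          simp [ht] at this
        have h1 : p.natDegree < k - 1 := (natDegree_lt_iff_degree_lt hpn).2 hdeg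
        by_cases hd0 : p.natDegree = 0
        · exfalso
          obtain ⟨c, hc⟩ := natDegree_eq_zero.1 hd0
          have e1 := hp ⟨0, by omega⟩
          have e2 := hp ⟨t, htk⟩
          rw [← hc] at e1 e2
          simp [ht] at e1 e2
          rw [e1] at e2
          exact one_ne_zero e2
        · have := natDegree_derivative_lt hd0
          omega
      · have hmono : ∀ i j : Fin (k - 1), (i : ℕ) + 1 ≠ t → (j : ℕ) + 1 ≠ t → i < j →
            x i < x j := by
          intro i j hi hj hij
          have h1 := (hx i hi).2
          have h2 := (hx j hj).1
          have h3 : (a ⟨i + 1, by omega⟩ : ℝ) ≤ (a ⟨j, by omega⟩ : ℝ) := by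
            exact_mod_cast ha.monotone (by simpa [Fin.le_def] using hij)
          linarith
        intro i hi j hj hij
        simp only [Finset.coe_filter, Finset.mem_univ, true_and, Set.mem_ofPred_eq] at hi hj
        rcases lt_trichotomy i j with h | h | h
        · exact absurd hij (hmono i j hi hj h).ne
        · exact h
        · exact absurd hij (hmono j i hj hi h).ne'
  have hc := derivative_eq_zero.1 hder
  obtain ⟨c, hc⟩ := natDegree_eq_zero.1 hc
  have e1 := hp ⟨0, by omega⟩
  have e2 := hp ⟨t, htk⟩
  rw [← hc] at e1 e2
  simp [ht] at e1 e2
  rw [e1] at e2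
  exact one_ne_zero e2

/-- A divided difference functional does not vanish on the indicator function of a proper
nonempty initial segment. -/
theorem IsWeight.sum_initial_ne_zero {k : ℕ} {a W : Fin k → ℤ} (hW : IsWeight a W)
    (ha : StrictMono a) {s : Fin k → Prop} [DecidablePred s]
    (hs : ∀ i j, i ≤ j → s j → s i) (h1 : ∃ i, s i) (h2 : ∃ i, ¬ s i) :
    ∑ i : Fin k, (W i : ℝ) * (if s i then 1 else 0) ≠ 0 := by
  classical
  obtain ⟨i1, hi1⟩ := h1
  obtain ⟨i2, hi2⟩ := h2
  have hex : ∃ t : ℕ, ∃ h : t < k, ¬ s ⟨t, h⟩ := ⟨i2, i2.2, hi2⟩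
  have htk : Nat.find hex < k := (Nat.find_spec hex).1
  have hts : ¬ s ⟨Nat.find hex, htk⟩ := (Nat.find_spec hex).2
  have hiff : ∀ i : Fin k, s i ↔ (i : ℕ) < Nat.find hex := by
    intro i
    constructor
    · intro hi
      by_contra hlt
      exact hts (hs _ i (by simpa [Fin.le_def] using hlt) hi)
    · intro hi
      by_contra hsi
      exact Nat.find_min hex hi ⟨i.2, hsi⟩
  generalize Nat.find hex = t at htk hiff
  have := hW.sum_lt_ne_zero ha (lt_of_le_of_lt (Nat.zero_le _) ((hiff i1).1 hi1)) htk
  simpa only [hiff] using this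

/-- The weighted sum of `s`-th powers along a progression vanishes for `s + 2 ≤ k`. -/
theorem IsWeight.sum_pow {k : ℕ} {a W : Fin k → ℤ} (hW : IsWeight a W) {s : ℕ} (hs : s + 2 ≤ k)
    (n d : ℤ) : ∑ i, W i * (n + a i * d) ^ s = 0 := by
  have h := hW.sum_eval ((C (n : ℝ) + X * C (d : ℝ)) ^ s) (by
    refine lt_of_le_of_lt (degree_le_natDegree) ?_
    have : ((C (n : ℝ) + X * C (d : ℝ)) ^ s).natDegree ≤ s := by
      refine natDegree_pow_le.trans ?_
      have : (C (n : ℝ) + X * C (d : ℝ)).natDegree ≤ 1 := by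
        compute_degree
      nlinarith
    have h2 : ((C (n : ℝ) + X * C (d : ℝ)) ^ s).natDegree < k - 1 := by omega
    exact WithBot.coe_lt_coe.2 h2)
  have hev : ∀ i, ((C (n : ℝ) + X * C (d : ℝ)) ^ s : ℝ[X]).eval (a i : ℝ) = (n + a i * d) ^ s := by
    intro i
    rw [eval_pow, eval_add, eval_mul, eval_C, eval_C, eval_X]
  simp_rw [hev] at h
  have h3 : ((∑ i, W i * (n + a i * d) ^ s : ℤ) : ℝ) = 0 := by
    push_cast
    exact h
  exact_mod_cast h3

end Weights

/-! ### Dual functions and the Cauchy–Schwarz inequality -/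

section Dual

theorem pow_expect_le {ι : Type*} [Fintype ι] [Nonempty ι] (f : ι → ℝ) (hf : ∀ i, 0 ≤ f i)
    (n : ℕ) : (𝔼 i, f i) ^ n ≤ 𝔼 i, f i ^ n := by
  have h := Real.pow_arith_mean_le_arith_mean_pow Finset.univ
    (fun _ : ι => ((Fintype.card ι : ℝ))⁻¹) f (fun _ _ => by positivity) (by simp)
    (fun i _ => hf i) n
  rw [Fintype.expect_eq_sum_div_card, Fintype.expect_eq_sum_div_card, div_eq_inv_mul,
    div_eq_inv_mul, Finset.mul_sum, Finset.mul_sum]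
  exact h

variable {G : Type*} [AddCommGroup G]

/-- Products of bounded functions of the nonzero vertices of a cube, as they arise in the dual
functions of the Gowers norms. -/
def IsDual : (s : ℕ) → ((Fin s → G) → G → ℂ) → Prop
  | 0, F => ∀ h n, F h n = 1
  | s + 1, F => ∃ F₁ : (Fin s → G) → G → ℂ, ∃ B : (Fin s → G) → G → ℂ, IsDual s F₁ ∧
      (∀ h n, ‖B h n‖ ≤ 1) ∧ ∀ t h n, F (Fin.cons t h) n = F₁ h n * B h (n - t)

theorem IsDual.norm_le {s : ℕ} : ∀ {F : (Fin s → G) → G → ℂ}, IsDual s F → ∀ h n, ‖F h n‖ ≤ 1 := by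
  induction s with
  | zero => intro F hF h n; rw [hF h n, norm_one]
  | succ s ih =>
    rintro F ⟨F₁, B, hF₁, hB, hF⟩ h n
    rw [← Fin.cons_self_tail h, hF, norm_mul]
    exact mul_le_one₀ (ih hF₁ _ _) (norm_nonneg _) (hB _ _)

theorem norm_mulDeriv_le {f : G → ℂ} (hf : ∀ n, ‖f n‖ ≤ 1) (h n : G) : ‖mulDeriv h f n‖ ≤ 1 := by
  unfold mulDeriv
  rw [norm_mul, RCLike.norm_conj]
  exact mul_le_one₀ (hf _) (norm_nonneg _) (hf _)

theorem mulDeriv_mul (u : G) (f g : G → ℂ) (n : G) :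
    mulDeriv u (fun m => f m * g m) n = mulDeriv u f n * mulDeriv u g n := by
  simp only [mulDeriv, map_mul]
  ring

theorem IsDual.mulDeriv {s : ℕ} : ∀ {F : (Fin s → G) → G → ℂ}, IsDual s F → ∀ u : G,
    IsDual s (fun h => mulDeriv u (F h)) := by
  induction s with
  | zero => intro F hF u h n; simp [PatternAP.mulDeriv, hF h]
  | succ s ih =>
    rintro F ⟨F₁, B, hF₁, hB, hF⟩ u
    refine ⟨fun h => PatternAP.mulDeriv u (F₁ h), fun h => PatternAP.mulDeriv u (B h), ih hF₁ u,
      fun h n => norm_mulDeriv_le (hB h) u n, fun t h n => ?_⟩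
    simp only [PatternAP.mulDeriv, hF, map_mul]
    rw [sub_right_comm n u t]
    ring

theorem IsDual.one (s : ℕ) : IsDual s (fun (_ : Fin s → G) (_ : G) => (1 : ℂ)) := by
  induction s with
  | zero => intro h n; rfl
  | succ s ih => exact ⟨_, fun _ _ => 1, ih, by simp, by simp⟩

theorem exists_isDual_foldr (s : ℕ) {f : G → ℂ} (hf : ∀ n, ‖f n‖ ≤ 1) :
    ∃ F : (Fin s → G) → G → ℂ, IsDual s F ∧
      ∀ h n, (List.ofFn h).foldr PatternAP.mulDeriv f n = f n * F h n := by
  induction s with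
  | zero => exact ⟨fun _ _ => 1, fun _ _ => rfl, fun h n => by simp⟩
  | succ s ih =>
    obtain ⟨F, hF, hfF⟩ := ih
    set B : (Fin s → G) → G → ℂ := fun h m => conj (f m * F h m) with hB
    refine ⟨fun h n => F (Fin.tail h) n * B (Fin.tail h) (n - h 0), ⟨F, B, hF, ?_, ?_⟩, ?_⟩
    · intro h n
      rw [hB, RCLike.norm_conj, norm_mul]
      exact mul_le_one₀ (hf _) (norm_nonneg _) (hF.norm_le _ _)
    · intro t h n
      simp
    · intro h n
      rw [List.ofFn_succ, List.foldr_cons]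
      unfold PatternAP.mulDeriv
      rw [show (fun i : Fin s => h i.succ) = Fin.tail h from rfl]
      have := hfF (Fin.tail h)
      unfold PatternAP.mulDeriv at this
      rw [this, this, hB]
      ring

variable [Fintype G]

/-- The average size of the mean values of the iterated derivatives of `φ`. -/
def derivMean : ℕ → (G → ℂ) → ℝ
  | 0, φ => ‖𝔼 n, φ n‖
  | s + 1, φ => 𝔼 u, derivMean s (mulDeriv u φ)

theorem derivMean_le_one (s : ℕ) : ∀ {φ : G → ℂ}, (∀ n, ‖φ n‖ ≤ 1) → derivMean s φ ≤ 1 := by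
  induction s with
  | zero =>
    intro φ hφ
    exact (RCLike.norm_expect_le (K := ℂ)).trans (Finset.expect_le Finset.univ_nonempty fun n _ => hφ n)
  | succ s ih =>
    intro φ hφ
    exact Finset.expect_le Finset.univ_nonempty fun u _ => ih fun n => norm_mulDeriv_le hφ u n

theorem expect_cons {G : Type*} [Fintype G] {s : ℕ} (Φ : (Fin (s + 1) → G) → ℂ) :
    𝔼 h, Φ h = 𝔼 h : Fin s → G, 𝔼 t : G, Φ (Fin.cons t h) := by
  rw [Finset.expect_comm, ← Finset.expect_product', Finset.univ_product_univ]
  exact (Fintype.expect_equiv (Fin.consEquiv (fun _ => G)) _ _ fun p => rfl).symm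

/-- One application of the Cauchy–Schwarz inequality. -/
theorem dual_step {s : ℕ} {F : (Fin (s + 1) → G) → G → ℂ} {F₁ B : (Fin s → G) → G → ℂ}
    (hB : ∀ h n, ‖B h n‖ ≤ 1) (hF : ∀ t h n, F (Fin.cons t h) n = F₁ h n * B h (n - t))
    (φ : G → ℂ) :
    ‖𝔼 h, 𝔼 n, φ n * F h n‖ ≤ 𝔼 h : Fin s → G, ‖𝔼 n, φ n * F₁ h n‖ := by
  rw [expect_cons]
  refine (RCLike.norm_expect_le (K := ℂ)).trans (Finset.expect_le_expect fun h _ => ?_)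
  -- For fixed `n` the point `n - t` is equidistributed, so the average of `B` splits off.
  have h1 : 𝔼 t : G, 𝔼 n : G, φ n * F (Fin.cons t h) n
      = (𝔼 n, φ n * F₁ h n) * 𝔼 m, B h m := by
    rw [Finset.expect_comm, Finset.expect_mul]
    refine Finset.expect_congr rfl fun n _ => ?_
    simp_rw [hF, ← mul_assoc]
    rw [← Finset.mul_expect]
    congr 1
    exact Fintype.expect_equiv (Equiv.subLeft n) _ _ fun _ => rfl
  rw [h1, norm_mul]
  refine mul_le_of_le_one_right (norm_nonneg _) ?_
  exact (RCLike.norm_expect_le (K := ℂ)).trans (Finset.expect_le Finset.univ_nonempty fun n _ => hB h n)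

/-- Correlations with dual functions are controlled by iterated derivatives. -/
theorem norm_expect_mul_dual_le (s : ℕ) : ∀ {F : (Fin (s + 1) → G) → G → ℂ}, IsDual (s + 1) F →
    ∀ φ : G → ℂ, ‖𝔼 h, 𝔼 n, φ n * F h n‖ ^ 2 ^ s ≤ derivMean s φ := by
  induction s with
  | zero =>
    rintro F ⟨F₁, B, hF₁, hB, hF⟩ φ
    have h := dual_step hB hF φ
    simpa [hF₁ _ _, derivMean] using h
  | succ s ih =>
    rintro F ⟨F₁, B, hF₁, hB, hF⟩ φ
    -- Squaring the inner mean differentiates both `φ` and `F₁ h`. Derivatives of dual functions are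
    -- dual again, so the induction continues with one variable fewer.
    have h1 : ‖𝔼 h, 𝔼 n, φ n * F h n‖ ^ 2
        ≤ 𝔼 u : G, ‖𝔼 h : Fin (s + 1) → G, 𝔼 n, mulDeriv u φ n * mulDeriv u (F₁ h) n‖ := by
      calc ‖𝔼 h, 𝔼 n, φ n * F h n‖ ^ 2
          ≤ (𝔼 h : Fin (s + 1) → G, ‖𝔼 n, φ n * F₁ h n‖) ^ 2 := by
            gcongr
            exact dual_step hB hF φ
        _ ≤ 𝔼 h : Fin (s + 1) → G, ‖𝔼 n, φ n * F₁ h n‖ ^ 2 :=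
            pow_expect_le _ (fun _ => norm_nonneg _) 2
        _ = ‖((𝔼 h : Fin (s + 1) → G, ‖𝔼 n, φ n * F₁ h n‖ ^ 2 : ℝ) : ℂ)‖ := by
            rw [Complex.norm_real, Real.norm_of_nonneg]
            exact Finset.expect_nonneg fun _ _ => by positivity
        _ = ‖𝔼 u : G, 𝔼 h : Fin (s + 1) → G, 𝔼 n, mulDeriv u φ n * mulDeriv u (F₁ h) n‖ := by
            rw [Complex.ofReal_expect]
            simp_rw [← expect_mulDeriv, mulDeriv_mul]
            rw [Finset.expect_comm]
        _ ≤ _ := (RCLike.norm_expect_le (K := ℂ))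
    calc ‖𝔼 h, 𝔼 n, φ n * F h n‖ ^ 2 ^ (s + 1)
        = (‖𝔼 h, 𝔼 n, φ n * F h n‖ ^ 2) ^ 2 ^ s := by rw [← pow_mul, pow_succ']
      _ ≤ (𝔼 u : G, ‖𝔼 h : Fin (s + 1) → G, 𝔼 n, mulDeriv u φ n * mulDeriv u (F₁ h) n‖) ^ 2 ^ s := by
          gcongr
      _ ≤ 𝔼 u : G, ‖𝔼 h : Fin (s + 1) → G, 𝔼 n, mulDeriv u φ n * mulDeriv u (F₁ h) n‖ ^ 2 ^ s :=
          pow_expect_le _ (fun _ => norm_nonneg _) _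
      _ ≤ 𝔼 u : G, derivMean s (mulDeriv u φ) :=
          Finset.expect_le_expect fun u _ => ih (hF₁.mulDeriv u) _

end Dual

/-! ### Polynomial phases and Fourier expansion of arcs -/

section Phase

open Polynomial ZMod

variable {N : ℕ}

/-- This is the polynomial `P(n) - P(n - u)`, the exponent of the derivative of a phase. The formula
shows that its leading coefficient survives modulo a prime exceeding `s + 1`. -/
theorem coeff_sub_taylor_eq {R : Type*} [CommRing R] {P : R[X]} {s : ℕ} (hP : P.natDegree ≤ s + 1)
    (u : R) : (P - taylor (-u) P).natDegree ≤ s ∧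
      (P - taylor (-u) P).coeff s = (s + 1 : ℕ) * P.coeff (s + 1) * u := by
  constructor
  · rw [natDegree_le_iff_coeff_eq_zero]
    intro m hm
    have h0 : (hasseDeriv m P).natDegree = 0 := by
      have := natDegree_hasseDeriv_le P m
      omega
    rw [coeff_sub, taylor_coeff, eq_C_of_natDegree_eq_zero h0, eval_C, hasseDeriv_coeff]
    simp
  · have h1 : (hasseDeriv s P).natDegree ≤ 1 := by
      have := natDegree_hasseDeriv_le P s
      omega
    rw [coeff_sub, taylor_coeff, eq_X_add_C_of_natDegree_le_one h1]
    simp only [eval_add, eval_mul, eval_C, eval_X, hasseDeriv_coeff]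
    rw [zero_add, Nat.choose_self, add_comm 1 s, Nat.choose_succ_self_right]
    push_cast
    ring

theorem sum_stdAddChar_mul [NeZero N] (b : ZMod N) :
    ∑ x : ZMod N, stdAddChar (x * b) = if b = 0 then (N : ℂ) else 0 := by
  have h := AddChar.sum_mulShift b (isPrimitive_stdAddChar N)
  simpa [ZMod.card] using h

theorem norm_stdAddChar [NeZero N] (x : ZMod N) : ‖stdAddChar x‖ = 1 := Circle.norm_coe _

/-- Polynomial phases of degree `s + 1` on a prime field have small derivatives on average. -/
theorem derivMean_phase_le (hN : N.Prime) [NeZero N] (s : ℕ) : ∀ {P : (ZMod N)[X]}, s + 1 < N →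
    P.natDegree ≤ s + 1 → P.coeff (s + 1) ≠ 0 →
    derivMean s (fun n => stdAddChar (P.eval n)) ≤ s / N := by
  have := Fact.mk hN
  induction s with
  | zero =>
    intro P _ hP hc
    have hz : 𝔼 n : ZMod N, stdAddChar (P.eval n) = 0 := by
      rw [Fintype.expect_eq_sum_div_card]
      have : ∀ n : ZMod N, stdAddChar (P.eval n)
          = stdAddChar (n * P.coeff 1) * stdAddChar (P.coeff 0) := by
        intro n
        rw [← AddChar.map_add_eq_mul]
        congr 1
        have he := congrArg (eval n) (eq_X_add_C_of_natDegree_le_one hP)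
        rw [eval_add, eval_mul, eval_C, eval_C, eval_X] at he
        rw [he, mul_comm n]
      simp_rw [this]
      rw [← Finset.sum_mul, sum_stdAddChar_mul, if_neg hc, zero_mul, zero_div]
    simp [derivMean, hz]
  | succ s ih =>
    intro P hs hP hc
    have hnorm : ∀ x : ZMod N, ‖stdAddChar x‖ ≤ 1 := fun x => (norm_stdAddChar x).le
    have hder : ∀ u : ZMod N, mulDeriv u (fun n => stdAddChar (P.eval n))
        = fun n => stdAddChar ((P - taylor (-u) P).eval n) := by
      intro u
      funext n
      rw [eval_sub, taylor_eval, ← sub_eq_add_neg, sub_eq_add_neg (eval n P),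
        AddChar.map_add_eq_mul, AddChar.map_neg_eq_conj]
      rfl
    -- Only `u = 0` destroys the leading coefficient, so each differencing costs `1 / N`.
    have hle : ∀ u : ZMod N, derivMean s (mulDeriv u (fun n => stdAddChar (P.eval n)))
        ≤ (if u = 0 then 1 else 0) + (s : ℝ) / N := by
      intro u
      by_cases hu : u = 0
      · rw [if_pos hu]
        have := derivMean_le_one s (φ := mulDeriv u (fun n => stdAddChar (P.eval n)))
          (fun n => norm_mulDeriv_le (fun n => hnorm _) u n)
        have h2 : (0 : ℝ) ≤ s / N := by positivity
        linarith
      · rw [if_neg hu, zero_add, hder]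
        obtain ⟨h1, h2⟩ := coeff_sub_taylor_eq hP u
        refine ih (by omega) h1 ?_
        rw [h2]
        refine mul_ne_zero (mul_ne_zero ?_ hc) hu
        rw [Ne, natCast_eq_zero_iff]
        exact fun h => absurd (Nat.le_of_dvd (by omega) h) (by omega)
    calc derivMean (s + 1) (fun n => stdAddChar (P.eval n))
        ≤ 𝔼 u : ZMod N, ((if u = 0 then (1 : ℝ) else 0) + (s : ℝ) / N) :=
          Finset.expect_le_expect fun u _ => hle u
      _ = ((s + 1 : ℕ) : ℝ) / N := by
          rw [Finset.expect_add_distrib, Fintype.expect_const, Fintype.expect_eq_sum_div_card]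
          simp [ZMod.card]
          ring

/-- The distance is `2 sin (π v / N)`, and Jordan's inequality bounds it below by `4 / N` times the
smaller of `v` and `N - v`. Adding both reciprocals avoids the minimum and leads to harmonic sums.
-/
theorem norm_stdAddChar_sub_one_inv_le [NeZero N] {x : ZMod N} (hx : x ≠ 0) :
    ‖stdAddChar x - 1‖⁻¹ ≤ (N : ℝ) / 4 * ((x.val : ℝ)⁻¹ + ((N : ℝ) - x.val)⁻¹) := by
  have hN : (0 : ℝ) < N := by exact_mod_cast NeZero.pos N
  set v : ℝ := (x.val : ℝ) with hv
  have hv0 : 0 < v := by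
    rw [hv]; exact_mod_cast Nat.pos_of_ne_zero ((ZMod.val_ne_zero x).2 hx)
  have hvN : v < N := by rw [hv]; exact_mod_cast ZMod.val_lt x
  have h1 : ‖stdAddChar x - 1‖ = 2 * Real.sin (Real.pi * (v / N)) := by
    have h2 : stdAddChar x = Complex.exp (Complex.I * ((2 * Real.pi * (v / N) : ℝ) : ℂ)) := by
      rw [stdAddChar_apply, toCircle_apply]
      congr 1
      push_cast [hv]
      ring
    rw [h2, Complex.norm_exp_I_mul_ofReal_sub_one, Real.norm_eq_abs, abs_of_nonneg]
    · congr 2; ring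
    · refine mul_nonneg (by norm_num) (Real.sin_nonneg_of_nonneg_of_le_pi (by positivity) ?_)
      have : v / N ≤ 1 := (div_le_one hN).2 hvN.le
      nlinarith [Real.pi_pos]
  rw [h1]
  have key : ∀ w : ℝ, 0 < w → w ≤ N / 2 → 4 * w / N ≤ 2 * Real.sin (Real.pi * (w / N)) := by
    intro w hw hw2
    have := Real.mul_le_sin (x := Real.pi * (w / N)) (by positivity) (by
      have : w / N ≤ 1 / 2 := by rw [div_le_iff₀ hN]; linarith
      nlinarith [Real.pi_pos])
    have h3 : 2 / Real.pi * (Real.pi * (w / N)) = 2 * (w / N) := by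
      field_simp
    rw [h3] at this
    rw [mul_div_assoc]
    linarith
  have hp1 : 0 < v⁻¹ := inv_pos.2 hv0
  have hp2 : 0 < ((N : ℝ) - v)⁻¹ := inv_pos.2 (by linarith)
  rcases le_total v (N / 2) with h | h
  · calc (2 * Real.sin (Real.pi * (v / N)))⁻¹ ≤ (4 * v / N)⁻¹ := by
          gcongr
          exact key v hv0 h
      _ = N / 4 * v⁻¹ := by field_simp
      _ ≤ _ := by gcongr; linarith
  · have hsin : Real.sin (Real.pi * (v / N)) = Real.sin (Real.pi * ((N - v) / N)) := by
      rw [← Real.sin_pi_sub]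
      congr 1
      field_simp
    have hw : 0 < (N : ℝ) - v := by linarith
    calc (2 * Real.sin (Real.pi * (v / N)))⁻¹ ≤ (4 * (N - v) / N)⁻¹ := by
          rw [hsin]
          gcongr
          exact key _ hw (by linarith)
      _ = N / 4 * (N - v)⁻¹ := by field_simp
      _ ≤ _ := by gcongr; linarith

theorem sum_zmod_val {M : Type*} [AddCommMonoid M] [NeZero N] (g : ℕ → M) :
    ∑ x : ZMod N, g x.val = ∑ v ∈ Finset.range N, g v := by
  refine Finset.sum_nbij' (fun x => x.val) (fun v => (v : ZMod N)) ?_ ?_ ?_ ?_ ?_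
  · intro x _; exact Finset.mem_range.2 (ZMod.val_lt x)
  · intro v _; exact Finset.mem_univ _
  · intro x _; exact ZMod.natCast_zmod_val x
  · intro v hv; exact ZMod.val_cast_of_lt (Finset.mem_range.1 hv)
  · intro x _; rfl

theorem sum_range_inv_le (N : ℕ) :
    ∑ v ∈ Finset.range (N - 1), ((v : ℝ) + 1)⁻¹ ≤ 1 + Real.log N := by
  have h := harmonic_le_one_add_log (N - 1)
  rw [harmonic] at h
  push_cast at h
  refine h.trans ?_
  gcongr 1 + ?_
  rcases Nat.eq_zero_or_pos (N - 1) with h0 | h0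
  · rw [h0]; simpa using Real.log_natCast_nonneg N
  · exact Real.log_le_log (by exact_mod_cast h0) (by exact_mod_cast Nat.sub_le N 1)

theorem sum_norm_stdAddChar_sub_one_inv_le [NeZero N] :
    ∑ x : ZMod N, (if x = 0 then 0 else ‖stdAddChar x - 1‖⁻¹) ≤ N / 2 * (1 + Real.log N) := by
  have hN : 0 < N := NeZero.pos N
  calc ∑ x : ZMod N, (if x = 0 then 0 else ‖stdAddChar x - 1‖⁻¹)
      ≤ ∑ x : ZMod N, (if x.val = 0 then 0 else
          (N : ℝ) / 4 * ((x.val : ℝ)⁻¹ + ((N : ℝ) - x.val)⁻¹)) := by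
        refine Finset.sum_le_sum fun x _ => ?_
        simp only [ZMod.val_eq_zero]
        split_ifs with h
        · exact le_rfl
        · exact norm_stdAddChar_sub_one_inv_le h
    _ = ∑ v ∈ Finset.range N, (if v = 0 then 0 else
          (N : ℝ) / 4 * ((v : ℝ)⁻¹ + ((N : ℝ) - v)⁻¹)) :=
        sum_zmod_val (fun v : ℕ => if v = 0 then (0 : ℝ) else
          (N : ℝ) / 4 * ((v : ℝ)⁻¹ + ((N : ℝ) - v)⁻¹))
    _ = ∑ v ∈ Finset.range (N - 1), (N : ℝ) / 4 *
          (((v : ℝ) + 1)⁻¹ + ((N : ℝ) - (v + 1))⁻¹) := by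
        obtain ⟨n, rfl⟩ : ∃ n, N = n + 1 := ⟨N - 1, by omega⟩
        rw [Finset.sum_range_succ']
        simp
    _ = (N : ℝ) / 4 * (∑ v ∈ Finset.range (N - 1), ((v : ℝ) + 1)⁻¹
          + ∑ v ∈ Finset.range (N - 1), ((v : ℝ) + 1)⁻¹) := by
        rw [← Finset.mul_sum, Finset.sum_add_distrib]
        congr 2
        rw [← Finset.sum_range_reflect]
        refine Finset.sum_congr rfl fun v hv => ?_
        have hv := Finset.mem_range.1 hv
        congr 1
        rw [Nat.cast_sub (by omega), Nat.cast_sub (by omega), Nat.cast_sub (by omega)]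
        push_cast
        ring
    _ ≤ (N : ℝ) / 4 * ((1 + Real.log N) + (1 + Real.log N)) := by
        gcongr <;> exact sum_range_inv_le N
    _ = N / 2 * (1 + Real.log N) := by ring

/-- The Fourier expansion of a cyclic interval, with its `ℓ¹` norm. -/
theorem exists_fourier_arc [NeZero N] (σ : ZMod N) {m : ℕ} (hm : m ≤ N) :
    ∃ c : ZMod N → ℂ, (∀ y : ZMod N, (if (y - σ).val < m then (1 : ℂ) else 0)
        = ∑ l, c l * stdAddChar (l * y)) ∧ c 0 = (m : ℂ) / N ∧
      ∑ l, ‖c l‖ ≤ 2 + Real.log N := by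
  have hN : 0 < N := NeZero.pos N
  have hNC : (N : ℂ) ≠ 0 := by exact_mod_cast hN.ne'
  refine ⟨fun l => (∑ v ∈ Finset.range m, stdAddChar (-l * (σ + (v : ZMod N)))) / N, ?_, ?_, ?_⟩
  · intro y
    have h1 : ∀ l : ZMod N, (∑ v ∈ Finset.range m, stdAddChar (-l * (σ + (v : ZMod N)))) / (N : ℂ)
        * stdAddChar (l * y)
        = (∑ v ∈ Finset.range m, stdAddChar (l * (y - (σ + (v : ZMod N))))) / N := by
      intro l
      rw [div_mul_eq_mul_div, Finset.sum_mul]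
      congr 1
      refine Finset.sum_congr rfl fun v _ => ?_
      rw [← AddChar.map_add_eq_mul]
      congr 1
      ring
    simp_rw [h1]
    rw [← Finset.sum_div, Finset.sum_comm]
    simp_rw [sum_stdAddChar_mul]
    have h2 : ∀ v ∈ Finset.range m, (if y - (σ + (v : ZMod N)) = 0 then (N : ℂ) else 0)
        = if v = (y - σ).val then (N : ℂ) else 0 := by
      intro v hv
      have hvm := Finset.mem_range.1 hv
      have : y - (σ + (v : ZMod N)) = 0 ↔ v = (y - σ).val := by
        rw [← sub_sub, sub_eq_zero]
        constructor
        · intro h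
          rw [h, ZMod.val_cast_of_lt (by omega)]
        · intro h
          rw [h, ZMod.natCast_zmod_val]
      simp only [this]
    rw [Finset.sum_congr rfl h2, Finset.sum_ite_eq']
    simp only [Finset.mem_range]
    split_ifs
    · rw [div_self hNC]
    · rw [zero_div]
  · simp
  · have h0 : ∀ l : ZMod N, ‖(∑ v ∈ Finset.range m, stdAddChar (-l * (σ + (v : ZMod N)))) / (N : ℂ)‖
        ≤ (if l = 0 then 1 else 0) + 2 / N * (if -l = 0 then 0 else ‖stdAddChar (-l) - 1‖⁻¹) := by
      intro l
      rw [norm_div, Complex.norm_natCast]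
      have hNR : (0 : ℝ) < N := by exact_mod_cast hN
      by_cases hl : l = 0
      · subst hl
        simp only [neg_zero, zero_mul, AddChar.map_zero_eq_one, Finset.sum_const,
          Finset.card_range, if_true, mul_zero, add_zero]
        rw [nsmul_one, Complex.norm_natCast, div_le_one hNR]
        exact_mod_cast hm
      · have hl' : -l ≠ 0 := neg_ne_zero.2 hl
        rw [if_neg hl, if_neg hl', zero_add]
        have hne : stdAddChar (-l) ≠ 1 := by
          intro h
          rw [← AddChar.map_zero_eq_one (stdAddChar (N := N))] at h
          exact hl' (injective_stdAddChar h)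
        have hgeom : ∑ v ∈ Finset.range m, stdAddChar (-l * (σ + (v : ZMod N)))
            = stdAddChar (-l * σ) * ((stdAddChar (-l) ^ m - 1) / (stdAddChar (-l) - 1)) := by
          rw [← geom_sum_eq hne, Finset.mul_sum]
          refine Finset.sum_congr rfl fun v _ => ?_
          rw [← AddChar.map_nsmul_eq_pow, ← AddChar.map_add_eq_mul]
          congr 1
          rw [nsmul_eq_mul]
          ring
        rw [hgeom, norm_mul, norm_stdAddChar, one_mul, norm_div]
        have h2 : ‖stdAddChar (-l) ^ m - 1‖ ≤ 2 := by
          refine (norm_sub_le _ _).trans ?_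
          rw [norm_pow, norm_stdAddChar, one_pow, norm_one]
          norm_num
        calc ‖stdAddChar (-l) ^ m - 1‖ / ‖stdAddChar (-l) - 1‖ / N
            ≤ 2 / ‖stdAddChar (-l) - 1‖ / N := by gcongr
          _ = _ := by ring
    calc _ ≤ ∑ l : ZMod N, ((if l = 0 then (1 : ℝ) else 0)
          + 2 / N * (if -l = 0 then 0 else ‖stdAddChar (-l) - 1‖⁻¹)) :=
          Finset.sum_le_sum fun l _ => h0 l
      _ = 1 + 2 / N * ∑ l : ZMod N, (if l = 0 then 0 else ‖stdAddChar l - 1‖⁻¹) := by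
          rw [Finset.sum_add_distrib, ← Finset.mul_sum]
          congr 1
          · simp
          · congr 1
            exact Equiv.sum_comp (Equiv.neg (ZMod N))
              (fun l : ZMod N => if l = 0 then 0 else ‖stdAddChar l - 1‖⁻¹)
      _ ≤ 1 + 2 / N * (N / 2 * (1 + Real.log N)) := by
          gcongr
          exact sum_norm_stdAddChar_sub_one_inv_le
      _ = 2 + Real.log N := by
          have : (N : ℝ) ≠ 0 := by exact_mod_cast hN.ne'
          field_simp
          ring

end Phase

/-! ### Correlation of phase sets with dual functions -/

section Uniform

open Polynomial ZMod

/-- The correlation with a dual function, as a linear functional. -/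
def dualPairing {G : Type*} [AddCommGroup G] [Fintype G] {s : ℕ} (F : (Fin s → G) → G → ℂ) :
    (G → ℂ) →ₗ[ℂ] ℂ where
  toFun φ := 𝔼 h, 𝔼 n, φ n * F h n
  map_add' φ ψ := by
    simp only [Pi.add_apply, add_mul, Finset.expect_add_distrib]
  map_smul' c φ := by
    simp only [Pi.smul_apply, smul_eq_mul, mul_assoc, Finset.mul_expect, RingHom.id_apply]

variable {N : ℕ}

/-- The set of `n` for which `n ^ s` lies in an interval of length `m` whose position depends on
the one among `M` blocks that contains `n`. -/
def phaseSet (s m M : ℕ) (τ : ℕ → ZMod N) : Set (ZMod N) :=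
  {n | (n ^ s - τ (M * n.val / N)).val < m}

theorem val_sub_lt_iff [NeZero N] {v₀ m : ℕ} (h : v₀ + m ≤ N) (n : ZMod N) :
    (n - (v₀ : ZMod N)).val < m ↔ v₀ ≤ n.val ∧ n.val < v₀ + m := by
  have hn := ZMod.val_lt n
  rcases le_or_gt v₀ n.val with hv | hv
  · have : n - (v₀ : ZMod N) = ((n.val - v₀ : ℕ) : ZMod N) := by
      rw [Nat.cast_sub hv, ZMod.natCast_zmod_val]
    rw [this, ZMod.val_cast_of_lt (by omega)]
    omega
  · have : n - (v₀ : ZMod N) = ((n.val + N - v₀ : ℕ) : ZMod N) := by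
      rw [Nat.cast_sub (by omega), Nat.cast_add, ZMod.natCast_zmod_val, ZMod.natCast_self,
        add_zero]
    rw [this, ZMod.val_cast_of_lt (by omega)]
    omega

/-- The block is the run of residues from `⌈b N / M⌉` up to, but excluding, `⌈(b + 1) N / M⌉`. As an
arc it has Fourier coefficients of logarithmic total size. -/
theorem exists_block_arc [NeZero N] {M b : ℕ} (hb : b < M) :
    ∃ σ : ZMod N, ∃ m ≤ N, ∀ n : ZMod N, M * n.val / N = b ↔ (n - σ).val < m := by
  have hN : 0 < N := NeZero.pos N
  have hM : 0 < M := by omega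
  have hmono : b * N ⌈/⌉ M ≤ (b + 1) * N ⌈/⌉ M := by
    rw [ceilDiv_le_iff_le_mul hM]
    exact (Nat.mul_le_mul_right N (Nat.le_succ b)).trans ((ceilDiv_le_iff_le_mul hM).1 le_rfl)
  have htop : (b + 1) * N ⌈/⌉ M ≤ N := by
    rw [ceilDiv_le_iff_le_mul hM]
    exact Nat.mul_le_mul_right N hb
  refine ⟨((b * N ⌈/⌉ M : ℕ) : ZMod N), (b + 1) * N ⌈/⌉ M - b * N ⌈/⌉ M, by omega, fun n => ?_⟩
  rw [val_sub_lt_iff (by omega), Nat.add_sub_cancel' hmono, ceilDiv_le_iff_le_mul hM,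
    ← not_le, ceilDiv_le_iff_le_mul hM, not_le, Nat.div_eq_iff hN]
  rw [Nat.add_mul, one_mul]
  omega

theorem norm_dualPairing_phase_le (hN : N.Prime) [NeZero N] {s : ℕ} (hs : 1 ≤ s) (hsN : s + 1 < N)
    {F : (Fin (s + 1) → ZMod N) → ZMod N → ℂ} (hF : IsDual (s + 1) F) (l u : ZMod N) (hu : u ≠ 0) :
    ‖dualPairing F (fun n => stdAddChar (l * n + u * n ^ (s + 1)))‖
      ≤ ((s : ℝ) / N) ^ ((2 ^ s : ℕ) : ℝ)⁻¹ := by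
  have := Fact.mk hN
  have h1 := norm_expect_mul_dual_le s hF (fun n => stdAddChar (l * n + u * n ^ (s + 1)))
  have h2 := derivMean_phase_le hN s (P := C l * X + C u * X ^ (s + 1)) hsN (by
      have : s + 1 ≥ 1 := by omega
      compute_degree!) (by
      rw [coeff_add, coeff_C_mul, coeff_C_mul, coeff_X_pow_self, coeff_X_of_ne_one (by omega)]
      simpa using hu)
  simp only [eval_add, eval_mul, eval_C, eval_X, eval_pow] at h2
  rw [Real.le_rpow_inv_iff_of_pos (norm_nonneg _) (by positivity) (by positivity),
    Real.rpow_natCast]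
  exact h1.trans h2

/-- Phase sets do not correlate with dual functions. -/
theorem norm_dualPairing_phaseSet_le (hN : N.Prime) [NeZero N] {s m M : ℕ} (hs : 1 ≤ s)
    (hsN : s + 1 < N) (hm : m ≤ N) (hM : 0 < M) (τ : ℕ → ZMod N)
    {F : (Fin (s + 1) → ZMod N) → ZMod N → ℂ} (hF : IsDual (s + 1) F) :
    ‖dualPairing F (fun n => (phaseSet (s + 1) m M τ).indicator (1 : ZMod N → ℂ) n - (m : ℂ) / N)‖
      ≤ M * (2 + Real.log N) ^ 2 * ((s : ℝ) / N) ^ ((2 ^ s : ℕ) : ℝ)⁻¹ := by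
  classical
  have hN0 : 0 < N := hN.pos
  have hblock : ∀ b ∈ Finset.range M, ∃ c : ZMod N → ℂ, (∀ n : ZMod N,
      (if M * n.val / N = b then (1 : ℂ) else 0) = ∑ l, c l * stdAddChar (l * n)) ∧
      ∑ l, ‖c l‖ ≤ 2 + Real.log N := by
    intro b hb
    obtain ⟨σ, m', hm', h⟩ := exists_block_arc (N := N) (Finset.mem_range.1 hb)
    obtain ⟨c, hc, -, hc1⟩ := exists_fourier_arc σ hm'
    exact ⟨c, fun n => by rw [← hc]; simp only [h], hc1⟩
  choose! c hc hc1 using hblock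
  choose c' hc' hc0 hc1' using fun b => exists_fourier_arc (τ b) hm
  -- The frequency `u = 0` of every arc has coefficient `m / N`, independent of the block.
  -- Subtracting the density removes it, so each remaining phase has degree exactly `s + 1`.
  have hexp : (fun n => (phaseSet (s + 1) m M τ).indicator (1 : ZMod N → ℂ) n - (m : ℂ) / N)
      = ∑ b ∈ Finset.range M, ∑ l, ∑ u ∈ Finset.univ.erase (0 : ZMod N),
        (c b l * c' b u) • fun n => stdAddChar (l * n + u * n ^ (s + 1)) := by
    funext n
    have hmem : M * n.val / N ∈ Finset.range M := by
      rw [Finset.mem_range, Nat.div_lt_iff_lt_mul hN0]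
      exact Nat.mul_lt_mul_of_pos_left (ZMod.val_lt n) hM
    have h1 : (phaseSet (s + 1) m M τ).indicator (1 : ZMod N → ℂ) n - (m : ℂ) / N
        = ∑ b ∈ Finset.range M, (if M * n.val / N = b then (1 : ℂ) else 0) *
          ((if (n ^ (s + 1) - τ b).val < m then (1 : ℂ) else 0) - m / N) := by
      simp only [ite_mul, one_mul, zero_mul]
      rw [Finset.sum_ite_eq, if_pos hmem]
      congr 1
      simp [phaseSet, Set.indicator_apply]
    rw [h1, Finset.sum_apply]
    refine Finset.sum_congr rfl fun b hb => ?_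
    rw [hc b hb n, hc' b, ← hc0 b, Finset.sum_apply, Finset.sum_mul]
    refine Finset.sum_congr rfl fun l _ => ?_
    rw [Finset.sum_apply, ← Finset.sum_erase_add _ _ (Finset.mem_univ (0 : ZMod N)), zero_mul,
      AddChar.map_zero_eq_one, mul_one, add_sub_cancel_right, Finset.mul_sum]
    refine Finset.sum_congr rfl fun u _ => ?_
    rw [Pi.smul_apply, smul_eq_mul, AddChar.map_add_eq_mul]
    ring
  set η := ((s : ℝ) / N) ^ ((2 ^ s : ℕ) : ℝ)⁻¹ with hη
  have hη0 : 0 ≤ η := by positivity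
  have hlog : 0 ≤ Real.log N := Real.log_natCast_nonneg N
  rw [hexp]
  simp only [map_sum, _root_.map_smul]
  calc _ ≤ ∑ b ∈ Finset.range M, ∑ l, ∑ u ∈ Finset.univ.erase (0 : ZMod N),
        ‖c b l‖ * ‖c' b u‖ * η := by
        refine (norm_sum_le _ _).trans (Finset.sum_le_sum fun b _ => ?_)
        refine (norm_sum_le _ _).trans (Finset.sum_le_sum fun l _ => ?_)
        refine (norm_sum_le _ _).trans (Finset.sum_le_sum fun u hu => ?_)
        rw [norm_smul, norm_mul]
        gcongr
        exact norm_dualPairing_phase_le hN hs hsN hF l u (Finset.ne_of_mem_erase hu)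
    _ ≤ ∑ b ∈ Finset.range M, ∑ l, ∑ u, ‖c b l‖ * ‖c' b u‖ * η := by
        gcongr
        exact Finset.erase_subset _ _
    _ = ∑ b ∈ Finset.range M, (∑ l, ‖c b l‖) * (∑ u, ‖c' b u‖) * η := by
        refine Finset.sum_congr rfl fun b _ => ?_
        rw [Finset.sum_mul_sum, Finset.sum_mul]
        simp_rw [Finset.sum_mul]
    _ ≤ ∑ b ∈ Finset.range M, (2 + Real.log N) * (2 + Real.log N) * η := by
        refine Finset.sum_le_sum fun b hb => ?_
        gcongr
        · exact hc1 b hb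
        · exact hc1' b
    _ = M * (2 + Real.log N) ^ 2 * η := by
        rw [Finset.sum_const, Finset.card_range, nsmul_eq_mul]
        ring

theorem tendsto_uniformity_bound (M s : ℕ) :
    Filter.Tendsto (fun N : ℕ => M * (2 + Real.log N) ^ 2 * ((s : ℝ) / N) ^ ((2 ^ s : ℕ) : ℝ)⁻¹)
      Filter.atTop (nhds 0) := by
  set e : ℝ := ((2 ^ s : ℕ) : ℝ)⁻¹ with he
  have he0 : 0 < e := by positivity
  have h1 : (fun x : ℝ => 2 + Real.log x) =o[Filter.atTop] fun x => x ^ (e / 2) := by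
    refine Asymptotics.IsLittleO.add ?_ (isLittleO_log_rpow_atTop (by positivity))
    exact Asymptotics.isLittleO_const_left.2 (Or.inr
      (tendsto_norm_atTop_atTop.comp (tendsto_rpow_atTop (by positivity))))
  have h2 := ((h1.tendsto_div_nhds_zero.comp tendsto_natCast_atTop_atTop).pow 2).const_mul
    ((M : ℝ) * (s : ℝ) ^ e)
  rw [zero_pow two_ne_zero, mul_zero] at h2
  refine h2.congr fun N => ?_
  simp only [Function.comp]
  rw [div_pow, ← Real.rpow_natCast ((N : ℝ) ^ (e / 2)), ← Real.rpow_mul (Nat.cast_nonneg N),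
    Real.div_rpow (Nat.cast_nonneg s) (Nat.cast_nonneg N)]
  have : e / 2 * ((2 : ℕ) : ℝ) = e := by push_cast; ring
  rw [this]
  ring

end Uniform

/-! ### Uniformity of phase sets -/

section UniformConclusion

variable {N : ℕ}

theorem norm_dualPairing_const_le {G : Type*} [AddCommGroup G] [Fintype G] {s : ℕ}
    {F : (Fin s → G) → G → ℂ} (hF : IsDual s F) (z : ℂ) : ‖dualPairing F (fun _ => z)‖ ≤ ‖z‖ := by
  refine (RCLike.norm_expect_le (K := ℂ)).trans (Finset.expect_le Finset.univ_nonempty fun h _ => ?_)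
  refine (RCLike.norm_expect_le (K := ℂ)).trans (Finset.expect_le Finset.univ_nonempty fun n _ => ?_)
  rw [norm_mul]
  exact mul_le_of_le_one_right (norm_nonneg _) (hF.norm_le _ _)

theorem norm_dualPairing_phaseSet_sub_le (hN : N.Prime) [NeZero N] {s M : ℕ} {α : ℝ} (hs : 1 ≤ s)
    (hsN : s + 1 < N) (hα : 0 < α) (hα1 : α < 1) (hM : 0 < M) (τ : ℕ → ZMod N)
    {F : (Fin (s + 1) → ZMod N) → ZMod N → ℂ} (hF : IsDual (s + 1) F) :
    ‖dualPairing F (fun n =>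
        (phaseSet (s + 1) ⌊α * N⌋₊ M τ).indicator (1 : ZMod N → ℂ) n - (α : ℂ))‖
      ≤ M * (2 + Real.log N) ^ 2 * ((s : ℝ) / N) ^ ((2 ^ s : ℕ) : ℝ)⁻¹ + 1 / N := by
  have hN0 : (0 : ℝ) < N := by exact_mod_cast hN.pos
  have hm : ⌊α * N⌋₊ ≤ N := by
    refine Nat.floor_le_of_le ?_
    nlinarith
  have hsplit : (fun n => (phaseSet (s + 1) ⌊α * N⌋₊ M τ).indicator (1 : ZMod N → ℂ) n - (α : ℂ))
      = (fun n => (phaseSet (s + 1) ⌊α * N⌋₊ M τ).indicator (1 : ZMod N → ℂ) n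
          - (⌊α * N⌋₊ : ℂ) / N) + fun _ => (⌊α * N⌋₊ : ℂ) / N - α := by
    funext n
    simp only [Pi.add_apply]
    ring
  rw [hsplit, map_add]
  refine (norm_add_le _ _).trans (add_le_add
    (norm_dualPairing_phaseSet_le hN hs hsN hm hM τ hF)
    ((norm_dualPairing_const_le hF _).trans ?_))
  have h1 : (⌊α * N⌋₊ : ℂ) / N - α = (((⌊α * N⌋₊ : ℝ) / N - α : ℝ) : ℂ) := by push_cast; rfl
  have h2 := Nat.floor_le (show 0 ≤ α * N by positivity)
  have h3 := Nat.lt_floor_add_one (α * N)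
  rw [h1, Complex.norm_real, Real.norm_eq_abs, abs_le]
  constructor
  · rw [neg_le_sub_iff_le_add, ← add_div, le_div_iff₀ hN0]
    linarith
  · rw [sub_le_iff_le_add, div_le_iff₀ hN0, add_mul, one_div, inv_mul_cancel₀ hN0.ne']
    linarith

/-- The Gowers average of `f` is the pairing of `f` with a dual function built from `f` itself. -/
theorem gowersNorm_le_of_dual {G : Type*} [AddCommGroup G] [Fintype G] {s : ℕ} {f : G → ℂ} {ε : ℝ}
    (hε : 0 ≤ ε) (hf : ∀ n, ‖f n‖ ≤ 1)
    (h : ∀ F, IsDual s F → ‖dualPairing F f‖ ≤ ε ^ 2 ^ s) : gowersNorm s f ≤ ε := by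
  obtain ⟨F, hF, hfF⟩ := exists_isDual_foldr s hf
  have h1 : gowersAvg s f = dualPairing F f := by
    unfold gowersAvg
    simp_rw [hfF]
    rfl
  unfold gowersNorm
  rw [h1, Real.rpow_inv_le_iff_of_pos (norm_nonneg _) hε (by positivity)]
  refine (h F hF).trans (le_of_eq ?_)
  rw [← Real.rpow_natCast]
  norm_num

theorem patternDensity_le_expect {G : Type*} [AddCommGroup G] [Fintype G] {k : ℕ} (a : Fin k → ℤ)
    (i : Fin k) (A : Set G) : patternDensity a A ≤ 𝔼 n, A.indicator (1 : G → ℝ) n := by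
  have h01 : ∀ n, 0 ≤ A.indicator (1 : G → ℝ) n ∧ A.indicator (1 : G → ℝ) n ≤ 1 := fun n =>
    ⟨Set.indicator_nonneg (fun _ _ => zero_le_one) _, Set.indicator_le_self' (by simp) n⟩
  calc patternDensity a A ≤ 𝔼 n : G, 𝔼 d : G, A.indicator (1 : G → ℝ) (n + a i • d) := by
        refine Finset.expect_le_expect fun n _ => Finset.expect_le_expect fun d _ => ?_
        rw [← Finset.mul_prod_erase _ _ (Finset.mem_univ i)]
        exact mul_le_of_le_one_right (h01 _).1
          (Finset.prod_le_one (fun _ _ => (h01 _).1) fun _ _ => (h01 _).2)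
    _ = 𝔼 d : G, 𝔼 n : G, A.indicator (1 : G → ℝ) (n + a i • d) := Finset.expect_comm _ _ _
    _ = 𝔼 _d : G, 𝔼 n, A.indicator (1 : G → ℝ) n :=
        Finset.expect_congr rfl fun d _ =>
          Fintype.expect_equiv (Equiv.addRight (a i • d)) _ _ fun _ => rfl
    _ = _ := Fintype.expect_const _

/-- Phase sets are uniform, and their pattern densities are at most about `α`. -/
theorem phaseSet_uniform {s M : ℕ} {α ε : ℝ} (hs : 1 ≤ s) (hα : 0 < α) (hα1 : α < 1)
    (hM : 0 < M) (hε : 0 < ε) : ∃ N₀ : ℕ, ∀ (N : ℕ) [NeZero N], N.Prime → N₀ ≤ N →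
      ∀ τ : ℕ → ZMod N,
      gowersNorm (s + 1) (fun n =>
        (phaseSet (s + 1) ⌊α * N⌋₊ M τ).indicator (1 : ZMod N → ℂ) n - (α : ℂ)) ≤ ε ∧
      ∀ (k : ℕ) (a : Fin k → ℤ), 0 < k →
        patternDensity a (phaseSet (s + 1) ⌊α * N⌋₊ M τ) ≤ α + ε := by
  have hlim := (tendsto_uniformity_bound M s).add tendsto_one_div_atTop_nhds_zero_nat
  rw [add_zero] at hlim
  have hε' : 0 < min (ε ^ 2 ^ (s + 1)) ε := lt_min (by positivity) hε
  obtain ⟨N₀, hN₀⟩ := Filter.eventually_atTop.1 (hlim.eventually_lt_const hε')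
  refine ⟨max N₀ (s + 2), fun N _ hN hN0 τ => ?_⟩
  have hb := hN₀ N ((le_max_left _ _).trans hN0)
  have hsN : s + 1 < N := lt_of_lt_of_le (by omega) ((le_max_right _ _).trans hN0)
  set A := phaseSet (s + 1) ⌊α * N⌋₊ M τ with hA
  have key : ∀ F, IsDual (s + 1) F →
      ‖dualPairing F (fun n => A.indicator (1 : ZMod N → ℂ) n - (α : ℂ))‖
        ≤ min (ε ^ 2 ^ (s + 1)) ε := fun F hF =>
    (norm_dualPairing_phaseSet_sub_le hN hs hsN hα hα1 hM τ hF).trans hb.le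
  refine ⟨gowersNorm_le_of_dual hε.le (fun n => ?_) fun F hF => (key F hF).trans (min_le_left _ _),
    fun k a hk => ?_⟩
  · by_cases hn : n ∈ A
    · rw [Set.indicator_of_mem hn, Pi.one_apply, ← Complex.ofReal_one, ← Complex.ofReal_sub,
        Complex.norm_real, Real.norm_of_nonneg (by linarith)]
      linarith
    · rw [Set.indicator_of_notMem hn, zero_sub, norm_neg, Complex.norm_real,
        Real.norm_of_nonneg hα.le]
      exact hα1.le
  · refine (patternDensity_le_expect a ⟨0, hk⟩ A).trans ?_
    -- Pairing with the constant dual function gives the density of `A`.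
    have h1 := (key _ (IsDual.one (s + 1))).trans (min_le_right _ _)
    have h2 : dualPairing (fun (_ : Fin (s + 1) → ZMod N) (_ : ZMod N) => (1 : ℂ))
        (fun n => A.indicator (1 : ZMod N → ℂ) n - (α : ℂ))
        = (((𝔼 n, A.indicator (1 : ZMod N → ℝ) n) - α : ℝ) : ℂ) := by
      change 𝔼 _h : Fin (s + 1) → ZMod N, 𝔼 n : ZMod N,
        (A.indicator (1 : ZMod N → ℂ) n - (α : ℂ)) * 1 = _
      simp only [mul_one]
      rw [Fintype.expect_const, Finset.expect_sub_distrib, Fintype.expect_const,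
        Complex.ofReal_sub, Complex.ofReal_expect]
      congr 2
      funext n
      by_cases hn : n ∈ A <;> simp [hn]
    rw [h2, Complex.norm_real, Real.norm_eq_abs] at h1
    linarith [(abs_le.1 h1).2]

end UniformConclusion

/-! ### Numbering colours and the consequences of the linear relation -/

section Colors

open Polynomial

/-- The lowest digit is divisible by `B` and smaller than `B`, hence zero. This lets one integer
equation encode `k` of them. -/
theorem digits_eq_zero {B : ℤ} (k : ℕ) : ∀ {T : ℕ → ℤ}, (∀ j < k, |T j| < B) →
    ∑ j ∈ Finset.range k, T j * B ^ j = 0 → ∀ j < k, T j = 0 := by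
  induction k with
  | zero => intro T _ _ j hj; omega
  | succ k ih =>
    intro T hT h
    have hB : 0 < B := (abs_nonneg _).trans_lt (hT 0 (by omega))
    rw [Finset.sum_range_succ', pow_zero, mul_one] at h
    have hfac : ∑ j ∈ Finset.range k, T (j + 1) * B ^ (j + 1)
        = B * ∑ j ∈ Finset.range k, T (j + 1) * B ^ j := by
      rw [Finset.mul_sum]
      exact Finset.sum_congr rfl fun j _ => by ring
    rw [hfac] at h
    have h0 : T 0 = 0 := Int.eq_zero_of_abs_lt_dvd
      ((Int.dvd_add_right (Dvd.intro _ rfl)).1 (by rw [h]; exact dvd_zero B)) (hT 0 (by omega))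
    rw [h0, add_zero] at h
    have := ih (T := fun j => T (j + 1)) (fun j hj => hT (j + 1) (by omega))
      ((mul_eq_zero.1 h).resolve_left hB.ne')
    intro j hj
    rcases j with _ | j
    · exact h0
    · exact this j (by omega)

/-- The `c i` take at most `k` values, on which every function agrees with a polynomial of degree
below `k`. -/
theorem sum_weight_eq_zero_of_moments {k : ℕ} {W : Fin k → ℤ} {c : Fin k → ℕ}
    (h : ∀ j < k, ∑ i, W i * (c i : ℤ) ^ j = 0) (φ : ℕ → ℝ) : ∑ i, (W i : ℝ) * φ (c i) = 0 := by
  classical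
  set S : Finset ℕ := Finset.univ.image c with hS
  have hinj : Set.InjOn (fun m : ℕ => (m : ℝ)) S := fun x _ y _ h => Nat.cast_injective h
  set p := Lagrange.interpolate S (fun m : ℕ => (m : ℝ)) φ with hp
  have hpv : ∀ i, p.eval (c i : ℝ) = φ (c i) := fun i =>
    Lagrange.eval_interpolate_at_node φ hinj (Finset.mem_image_of_mem c (Finset.mem_univ i))
  have hcard : S.card ≤ k := by
    simpa using (Finset.card_image_le (s := Finset.univ) (f := c))
  have hdeg : p.degree < k :=
    (Lagrange.degree_interpolate_lt φ hinj).trans_le (by exact_mod_cast hcard)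
  rcases Nat.eq_zero_or_pos k with hk | hk
  · subst hk; simp
  have hnat : p.natDegree < k := by
    by_cases hp0 : p = 0
    · rw [hp0, natDegree_zero]; exact hk
    · exact (natDegree_lt_iff_degree_lt hp0).2 hdeg
  calc ∑ i, (W i : ℝ) * φ (c i) = ∑ i, ∑ j ∈ Finset.range k, p.coeff j * (W i * (c i : ℝ) ^ j) := by
        refine Finset.sum_congr rfl fun i _ => ?_
        rw [← hpv i, eval_eq_sum_range' hnat, Finset.mul_sum]
        exact Finset.sum_congr rfl fun j _ => by ring
    _ = ∑ j ∈ Finset.range k, p.coeff j * ((∑ i, W i * (c i : ℤ) ^ j : ℤ) : ℝ) := by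
        rw [Finset.sum_comm]
        refine Finset.sum_congr rfl fun j _ => ?_
        push_cast
        rw [Finset.mul_sum]
    _ = 0 := by
        refine Finset.sum_eq_zero fun j hj => ?_
        rw [h j (Finset.mem_range.1 hj), Int.cast_zero, mul_zero]

theorem abs_sum_weight_mul_le {k : ℕ} (W : Fin k → ℤ) {x : Fin k → ℤ} {y : ℤ}
    (h : ∀ i, |x i| ≤ y) : |∑ i, W i * x i| ≤ (∑ i, |W i|) * y := by
  rw [Finset.sum_mul]
  refine (Finset.abs_sum_le_sum_abs _ _).trans (Finset.sum_le_sum fun i _ => ?_)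
  rw [abs_mul]
  exact mul_le_mul_of_nonneg_left (h i) (abs_nonneg _)

/-- A finite set of colours has a numbering that satisfies a given linear equation only if every
function of the colours does. -/
theorem exists_code {Γ : Type*} (S : Finset Γ) {k : ℕ} (W : Fin k → ℤ) {w : ℕ}
    (hw : ∑ i, |W i| ≤ w) :
    ∃ σ : Γ → ℕ, (∀ c ∈ S, σ c ≤ k * (S.card * (w * S.card ^ k + 1)) ^ k) ∧
      ∀ c : Fin k → Γ, (∀ i, c i ∈ S) → ∑ i, W i * (σ (c i) : ℤ) = 0 →
        ∀ φ : Γ → ℝ, ∑ i, (W i : ℝ) * φ (c i) = 0 := by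
  classical
  set R := S.card with hR
  set B := w * R ^ k + 1 with hB
  obtain ⟨e, he, hinj⟩ : ∃ e : Γ → ℕ, (∀ c ∈ S, e c < R) ∧ Set.InjOn e S := by
    refine ⟨fun c => if h : c ∈ S then (S.equivFin ⟨c, h⟩ : ℕ) else 0, fun c hc => ?_,
      fun c hc c' hc' h => ?_⟩
    · simp only [hc, dif_pos]
      exact (S.equivFin ⟨c, hc⟩).2
    · simp only [Finset.mem_coe] at hc hc'
      simp only [hc, hc', dif_pos] at h
      exact congrArg Subtype.val (S.equivFin.injective (Fin.ext h))
  -- The digits are the powers of the index of the colour. The base `B` exceeds every weighted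
  -- moment, so a vanishing weighted sum of codes makes all moments vanish.
  refine ⟨fun c => ∑ j ∈ Finset.range k, e c ^ j * B ^ j, fun c hc => ?_, fun c hc h0 φ => ?_⟩
  · have hR0 : 0 < R := (Nat.zero_le _).trans_lt (he c hc)
    calc ∑ j ∈ Finset.range k, e c ^ j * B ^ j ≤ ∑ j ∈ Finset.range k, (R * B) ^ k := by
          refine Finset.sum_le_sum fun j hj => ?_
          rw [← mul_pow]
          calc (e c * B) ^ j ≤ (R * B) ^ j := by
                gcongr
                exact (he c hc).le
            _ ≤ (R * B) ^ k := Nat.pow_le_pow_right (by positivity)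
                (Finset.mem_range.1 hj).le
      _ = _ := by rw [Finset.sum_const, Finset.card_range, smul_eq_mul]
  · rcases Nat.eq_zero_or_pos k with hk | hk
    · subst hk; simp
    have hR0 : 0 < R := (Nat.zero_le _).trans_lt (he _ (hc ⟨0, hk⟩))
    have hswap : ∑ j ∈ Finset.range k, (∑ i, W i * (e (c i) : ℤ) ^ j) * (B : ℤ) ^ j = 0 := by
      rw [← h0]
      push_cast
      simp_rw [Finset.mul_sum, Finset.sum_mul]
      rw [Finset.sum_comm]
      exact Finset.sum_congr rfl fun i _ => Finset.sum_congr rfl fun j _ => by ring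
    have hmom := digits_eq_zero k (fun j hj => by
      have h1 : |∑ i, W i * (e (c i) : ℤ) ^ j| ≤ (∑ i, |W i|) * (R : ℤ) ^ k :=
        abs_sum_weight_mul_le W fun i => by
          rw [abs_of_nonneg (by positivity)]
          calc (e (c i) : ℤ) ^ j ≤ (R : ℤ) ^ j := by
                gcongr
                exact_mod_cast (he _ (hc i)).le
            _ ≤ (R : ℤ) ^ k := pow_le_pow_right₀ (by exact_mod_cast hR0) hj.le
      have h2 : (∑ i, |W i|) * (R : ℤ) ^ k ≤ (w : ℤ) * R ^ k := by gcongr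
      rw [hB]
      push_cast
      linarith) hswap
    -- `φ` is transported to indices through a chosen preimage in `S`; the default colour is never
    -- reached at the indices `e (c i)`.
    have := sum_weight_eq_zero_of_moments (c := fun i => e (c i)) hmom
      (fun m => φ ((fun m => if h : ∃ x ∈ S, e x = m then h.choose else c ⟨0, hk⟩) m))
    rw [← this]
    refine Finset.sum_congr rfl fun i _ => ?_
    congr 2
    have hex : ∃ x ∈ S, e x = e (c i) := ⟨c i, hc i, rfl⟩
    simp only [hex, dif_pos]
    exact (hinj (hex.choose_spec.1) (hc i) hex.choose_spec.2).symm

variable {Γ : Type*} {k : ℕ} {a W : Fin k → ℤ} {c : Fin k → Γ}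

/-- If every function of the colours satisfies a linear equation without vanishing coefficients,
then no colour occurs only once. -/
theorem exists_ne_color_eq (hW : ∀ i, W i ≠ 0)
    (hc : ∀ φ : Γ → ℝ, ∑ i, (W i : ℝ) * φ (c i) = 0) (i : Fin k) : ∃ j, j ≠ i ∧ c j = c i := by
  classical
  by_contra hno
  push Not at hno
  have h := hc fun x => if x = c i then 1 else 0
  rw [Finset.sum_eq_single i (fun j _ hj => by simp [hno j hj]) (by simp)] at h
  simp [hW i] at h

/-- A quadratic function of `a i` that is nearly determined by the colour has small leading
coefficient, unless `a` is symmetric. -/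
theorem quadratic_coeff_le (hk : 0 < k) (ha : StrictMono a) (hsym : Odd k ∨ ¬ IsSymmetric a)
    (hW : ∀ i, W i ≠ 0) (hc : ∀ φ : Γ → ℝ, ∑ i, (W i : ℝ) * φ (c i) = 0) {A B G δ : ℝ}
    (h : ∀ i j, c i = c j →
      |(A + B * a i + G * (a i : ℝ) ^ 2) - (A + B * a j + G * (a j : ℝ) ^ 2)| ≤ δ) :
    G ≤ 2 * δ := by
  by_contra hG
  push Not at hG
  have hone : ∀ m : ℤ, m ≠ 0 → (1 : ℝ) ≤ |(m : ℝ)| := fun m hm => by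
    exact_mod_cast Int.one_le_abs hm
  have hpair : ∀ i j, c i = c j → i ≠ j → |B + G * (a i + a j)| ≤ δ := by
    intro i j hij hne
    have h1 := h i j hij
    have h2 : (A + B * a i + G * (a i : ℝ) ^ 2) - (A + B * a j + G * (a j : ℝ) ^ 2)
        = (B + G * (a i + a j)) * ((a i - a j : ℤ) : ℝ) := by push_cast; ring
    rw [h2, abs_mul] at h1
    have h3 := hone (a i - a j) (sub_ne_zero.2 fun e => hne (ha.injective e))
    nlinarith [abs_nonneg (B + G * (a i + a j))]
  have hδ : 0 ≤ δ := (abs_nonneg _).trans (h ⟨0, hk⟩ ⟨0, hk⟩ rfl)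
  -- Distinct integer sums differ by at least `1`, and subtracting the two bounds from `hpair` would
  -- then give `G ≤ 2 * δ`.
  have hsum : ∀ i j i' j', c i = c j → i ≠ j → c i' = c j' → i' ≠ j' →
      a i + a j = a i' + a j' := by
    intro i j i' j' h1 h2 h3 h4
    by_contra hne
    have e1 := hpair i j h1 h2
    have e2 := hpair i' j' h3 h4
    have e3 := hone (a i + a j - (a i' + a j')) (sub_ne_zero.2 hne)
    have e4 : |G * ((a i + a j - (a i' + a j') : ℤ) : ℝ)| ≤ 2 * δ := by
      have : G * ((a i + a j - (a i' + a j') : ℤ) : ℝ)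
          = (B + G * (a i + a j)) - (B + G * (a i' + a j')) := by push_cast; ring
      rw [this]
      refine (abs_sub _ _).trans ?_
      linarith
    rw [abs_mul, abs_of_nonneg (by linarith)] at e4
    nlinarith
  choose π hπ hπc using exists_ne_color_eq hW hc
  set s := a ⟨0, hk⟩ + a (π ⟨0, hk⟩) with hs
  have hs' : ∀ i, a i + a (π i) = s := fun i =>
    hsum _ _ _ _ (hπc i).symm (hπ i).symm (hπc _).symm (hπ _).symm
  -- The pairing shows that reflection preserves the set of nodes. Increasing enumerations of equal
  -- sets coincide, so `π` is order reversal.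
  have hrange : Set.range (fun i : Fin k => s - a i.rev) = Set.range a := by
    ext x
    constructor
    · rintro ⟨i, rfl⟩
      exact ⟨π i.rev, by have := hs' i.rev; simp only; omega⟩
    · rintro ⟨i, rfl⟩
      exact ⟨(π i).rev, by have := hs' i; simp only [Fin.rev_rev]; omega⟩
  have hmono : StrictMono fun i : Fin k => s - a i.rev := fun i j hij => by
    have := ha (Fin.rev_lt_rev.2 hij)
    simp only
    omega
  have hrev : ∀ i, s - a i.rev = a i := fun i => congrFun ((hmono.range_inj ha).1 hrange) i
  have hπrev : ∀ i, π i = i.rev := fun i => ha.injective (by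
    have h1 := hs' i
    have h2 := hrev i
    omega)
  -- For odd `k` the middle index would be its own partner.
  have heven : Even k := by
    by_contra hodd
    rw [Nat.not_even_iff_odd] at hodd
    obtain ⟨m, hm⟩ := hodd
    have := hπ ⟨m, by omega⟩
    rw [hπrev] at this
    exact this (Fin.ext (by simp [Fin.val_rev]; omega))
  rcases hsym with h1 | h1
  · exact (Nat.not_even_iff_odd.2 h1) heven
  · refine h1 ⟨heven, fun i j => ?_⟩
    have e1 := hrev i
    have e2 := hrev j
    omega

/-- If a short progression on the circle meets both sides of `0`, then the two sides are separated
by their colours, which is impossible. -/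
theorem fract_eq_of_color (hW : IsWeight a W) (ha : StrictMono a)
    (hc : ∀ φ : Γ → ℝ, ∑ i, (W i : ℝ) * φ (c i) = 0) (i₀ : Fin k) {z τ : ℝ} (hz0 : 0 ≤ z)
    (hz1 : z < 1) (hτ : ∀ i, |((a i : ℝ) - a i₀) * τ| ≤ 1 / 4) {g : Γ → ℤ}
    (hg : ∀ i, g (c i) = ⌊2 * Int.fract (z + ((a i : ℝ) - a i₀) * τ)⌋) (i : Fin k) :
    Int.fract (z + ((a i : ℝ) - a i₀) * τ) = z + ((a i : ℝ) - a i₀) * τ := by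
  classical
  set ζ : Fin k → ℝ := fun i => z + ((a i : ℝ) - a i₀) * τ with hζ
  have hζ0 : ζ i₀ = z := by simp [hζ]
  have hclose : ∀ i, |ζ i - z| ≤ 1 / 4 := fun i => by simpa [hζ] using hτ i
  have hfl0 : ∀ x : ℝ, 0 ≤ x → x < 1 / 2 → ⌊2 * x⌋ = 0 := fun x h1 h2 =>
    Int.floor_eq_iff.2 ⟨by push_cast; linarith, by push_cast; linarith⟩
  have hfl1 : ∀ x : ℝ, 1 / 2 ≤ x → x < 1 → ⌊2 * x⌋ = 1 := fun x h1 h2 =>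
    Int.floor_eq_iff.2 ⟨by push_cast; linarith, by push_cast; linarith⟩
  have hfr : ∀ (x : ℝ) (m : ℤ), (m : ℝ) ≤ x → x < m + 1 → Int.fract x = x - m := fun x m h1 h2 => by
    rw [Int.fract, Int.floor_eq_iff.2 ⟨h1, h2⟩]
  have hin : ∀ i, 0 ≤ ζ i → ζ i < 1 → Int.fract (ζ i) = ζ i := fun i h1 h2 =>
    Int.fract_eq_self.2 ⟨h1, h2⟩
  have hacast : ∀ i j, i ≤ j → (a i : ℝ) ≤ a j := fun i j h => by exact_mod_cast ha.monotone h
  have hcl := fun i => abs_le.1 (hclose i)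
  have htot : ∑ i, (W i : ℝ) = 0 := by simpa using hc fun _ => 1
  -- no colour classes are compatible with a proper splitting into initial and final segments
  have hno : ∀ s : Fin k → Prop, ∀ v : ℤ, (∀ i, g (c i) = v ↔ s i) →
      ((∀ i j, i ≤ j → s j → s i) ∨ (∀ i j, i ≤ j → s i → s j)) → (∃ i, s i) → (∃ i, ¬ s i) →
      False := by
    intro s v hs hmon h1 h2
    have hsum := hc fun x => if g x = v then 1 else 0
    simp only [hs] at hsum
    rcases hmon with hm | hm
    · exact hW.sum_initial_ne_zero ha hm h1 h2 hsum
    · refine hW.sum_initial_ne_zero ha (s := fun i => ¬ s i)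
        (fun i j hij hj hi => hj (hm i j hij hi)) h2 ?_ ?_
      · obtain ⟨i, hi⟩ := h1
        exact ⟨i, fun h => h hi⟩
      · have : ∀ i, (W i : ℝ) * (if ¬ s i then 1 else 0)
            = (W i : ℝ) - (W i : ℝ) * (if s i then 1 else 0) := fun i => by
          by_cases hi : s i <;> simp [hi]
        simp_rw [this]
        rw [Finset.sum_sub_distrib, htot, hsum, sub_zero]
  have hmonoζ : (∀ i j, i ≤ j → ζ i ≤ ζ j) ∨ (∀ i j, i ≤ j → ζ j ≤ ζ i) := by
    rcases le_total 0 τ with h | h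
    · left; intro i j hij
      have := hacast i j hij
      simp only [hζ]
      nlinarith
    · right; intro i j hij
      have := hacast i j hij
      simp only [hζ]
      nlinarith
  have hlow : ∀ i, 0 ≤ ζ i := by
    by_contra hex
    push Not at hex
    obtain ⟨i1, hi1⟩ := hex
    have hz4 : z < 1 / 4 := by linarith [(hcl i1).1]
    -- Terms below `0` wrap into the upper half while the others stay in the lower half. The colours
    -- thus cut off an initial or final segment, which is proper because it omits `i₀`.
    refine hno (fun i => ζ i < 0) 1 (fun i => ?_) ?_ ⟨i1, hi1⟩ ⟨i₀, by rw [hζ0]; exact not_lt.2 hz0⟩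
    · rw [hg]
      change ⌊2 * Int.fract (ζ i)⌋ = 1 ↔ _
      have h1 := (hcl i).1
      have h2 := (hcl i).2
      by_cases hi : ζ i < 0
      · rw [hfr (ζ i) (-1) (by push_cast; linarith) (by push_cast; linarith),
          hfl1 _ (by push_cast; linarith) (by push_cast; linarith)]
        simp [hi]
      · rw [hin i (not_lt.1 hi) (by linarith), hfl0 _ (not_lt.1 hi) (by linarith)]
        simp [hi]
    · rcases hmonoζ with h | h
      · left; intro i j hij hj; exact (h i j hij).trans_lt hj
      · right; intro i j hij hj; exact (h i j hij).trans_lt hj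
  have hhigh : ∀ i, ζ i < 1 := by
    by_contra hex
    push Not at hex
    obtain ⟨i1, hi1⟩ := hex
    have hz4 : 3 / 4 ≤ z := by linarith [(hcl i1).2]
    refine hno (fun i => 1 ≤ ζ i) 0 (fun i => ?_) ?_ ⟨i1, hi1⟩ ⟨i₀, by rw [hζ0]; exact not_le.2 hz1⟩
    · rw [hg]
      change ⌊2 * Int.fract (ζ i)⌋ = 0 ↔ _
      have h1 := (hcl i).1
      have h2 := (hcl i).2
      by_cases hi : 1 ≤ ζ i
      · rw [hfr (ζ i) 1 (by push_cast; linarith) (by push_cast; linarith),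
          hfl0 _ (by push_cast; linarith) (by push_cast; linarith)]
        simp [hi]
      · rw [hin i (hlow i) (not_le.1 hi), hfl1 _ (by linarith) (not_le.1 hi)]
        simp [hi]
    · rcases hmonoζ with h | h
      · right; intro i j hij hj; exact hj.trans (h i j hij)
      · left; intro i j hij hj; exact hj.trans (h i j hij)
  exact hin i (hlow i) (hhigh i)

end Colors

/-! ### The colouring of the circle -/

section Coloring

/-- A colouring of the circle: the positions of `M ^ j * x` and of `L * M ^ j * x` for `j < r` at
a bounded scale, and the rounded squared length of the vector of all `L * M ^ j * x`. -/
def color (K L P M r : ℕ) (x : ℝ) : (Fin r → ℤ × ℤ) × ℤ :=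
  (fun j => (⌊(K : ℝ) * Int.fract ((M : ℝ) ^ (j : ℕ) * x)⌋,
    ⌊2 * Int.fract ((L : ℝ) * (M : ℝ) ^ (j : ℕ) * x)⌋),
    ∑ j : Fin r, ⌊(P : ℝ) * Int.fract ((L : ℝ) * (M : ℝ) ^ (j : ℕ) * x)⌋ ^ 2)

/-- The possible values of `color`. -/
def colorSet (K P r : ℕ) : Finset ((Fin r → ℤ × ℤ) × ℤ) :=
  (Fintype.piFinset fun _ => Finset.Ico (0 : ℤ) K ×ˢ Finset.Ico (0 : ℤ) 2) ×ˢ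
    Finset.Ico (0 : ℤ) (r * P ^ 2 + 1 : ℕ)

theorem card_colorSet (K P r : ℕ) : (colorSet K P r).card = (K * 2) ^ r * (r * P ^ 2 + 1) := by
  rw [colorSet, Finset.card_product, Fintype.card_piFinset]
  simp only [Finset.card_product, Int.card_Ico, sub_zero, Int.toNat_natCast, Finset.prod_const,
    Finset.card_univ, Fintype.card_fin]
  rfl

theorem floor_mul_fract_mem {m : ℕ} (hm : 0 < m) (y : ℝ) :
    0 ≤ ⌊(m : ℝ) * Int.fract y⌋ ∧ ⌊(m : ℝ) * Int.fract y⌋ < m := by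
  have h0 := Int.fract_nonneg y
  have h1 := Int.fract_lt_one y
  have hm' : (0 : ℝ) < m := by exact_mod_cast hm
  refine ⟨Int.floor_nonneg.2 (by positivity), Int.floor_lt.2 ?_⟩
  push_cast
  nlinarith

theorem color_mem {K L P M r : ℕ} (hK : 0 < K) (hP : 0 < P) (x : ℝ) :
    color K L P M r x ∈ colorSet K P r := by
  rw [colorSet, Finset.mem_product, Fintype.mem_piFinset]
  refine ⟨fun j => ?_, ?_⟩
  · rw [Finset.mem_product, Finset.mem_Ico, Finset.mem_Ico]
    refine ⟨floor_mul_fract_mem hK _, ?_⟩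
    have := floor_mul_fract_mem (m := 2) (by norm_num) ((L : ℝ) * (M : ℝ) ^ (j : ℕ) * x)
    simpa [color] using this
  · rw [Finset.mem_Ico]
    have hdef : (color K L P M r x).2
        = ∑ j : Fin r, ⌊(P : ℝ) * Int.fract ((L : ℝ) * (M : ℝ) ^ (j : ℕ) * x)⌋ ^ 2 := rfl
    rw [hdef]
    refine ⟨Finset.sum_nonneg fun j _ => sq_nonneg _, ?_⟩
    have : ∑ j : Fin r, ⌊(P : ℝ) * Int.fract ((L : ℝ) * (M : ℝ) ^ (j : ℕ) * x)⌋ ^ 2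
        ≤ ∑ _j : Fin r, (P : ℤ) ^ 2 := by
      refine Finset.sum_le_sum fun j _ => ?_
      obtain ⟨h0, h1⟩ := floor_mul_fract_mem hP ((L : ℝ) * (M : ℝ) ^ (j : ℕ) * x)
      exact pow_le_pow_left₀ h0 h1.le 2
    rw [Finset.sum_const, Finset.card_univ, Fintype.card_fin, nsmul_eq_mul] at this
    push_cast
    exact Int.lt_add_one_of_le this

theorem floor_mul_fract (m : ℕ) (y : ℝ) :
    ⌊(m : ℝ) * Int.fract y⌋ = ⌊(m : ℝ) * y⌋ - m * ⌊y⌋ := by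
  have : (m : ℝ) * Int.fract y = (m : ℝ) * y - ((m * ⌊y⌋ : ℤ) : ℝ) := by
    rw [Int.fract]; push_cast; ring
  rw [this, Int.floor_sub_intCast]

/-- Since `m` divides `M'`, every multiple of `1 / m` is a block endpoint, so the floor does not
change inside a block. -/
theorem floor_mul_block {m M' v N : ℕ} (hM' : 0 < M') (hm : m ∣ M') :
    ⌊(m : ℝ) * ((v : ℝ) / N)⌋ = ⌊(m : ℝ) * (((M' * v / N : ℕ) : ℝ) / M')⌋ := by
  obtain ⟨d, rfl⟩ := hm
  have h : ∀ p q : ℕ, ⌊(m : ℝ) * ((p : ℝ) / q)⌋ = ((m * p / q : ℕ) : ℤ) := fun p q => by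
    rw [← mul_div_assoc, ← Nat.cast_mul]
    rw [← Int.natCast_floor_eq_floor (by positivity), Nat.floor_div_eq_div]
  rw [h, h, Nat.mul_div_mul_left _ _ (Nat.pos_of_mul_pos_right hM'), Nat.div_div_eq_div_mul,
    mul_comm N d, mul_comm m d, mul_assoc, Nat.mul_div_mul_left _ _ (Nat.pos_of_mul_pos_left hM')]

/-- The colour depends only on the block of a fixed length. -/
theorem color_block {K L P M r : ℕ} (hK : 0 < K) (hL : 0 < L) (hP : 0 < P) (hM : 0 < M)
    (v N : ℕ) : color K L P M r ((v : ℝ) / N) = color K L P M r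
      (((2 * K * L * P * M ^ r * v / N : ℕ) : ℝ) / (2 * K * L * P * M ^ r : ℕ)) := by
  have hM' : 0 < 2 * K * L * P * M ^ r := by positivity
  have key : ∀ m y : ℕ, m * y ∣ 2 * K * L * P * M ^ r →
      ⌊(m : ℝ) * Int.fract ((y : ℝ) * ((v : ℝ) / N))⌋ = ⌊(m : ℝ) * Int.fract ((y : ℝ) *
      (((2 * K * L * P * M ^ r * v / N : ℕ) : ℝ) / (2 * K * L * P * M ^ r : ℕ)))⌋ := by
    intro m y h
    rw [floor_mul_fract, floor_mul_fract, ← mul_assoc, ← mul_assoc, ← Nat.cast_mul,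
      floor_mul_block hM' h, floor_mul_block hM' (dvd_of_mul_left_dvd h)]
  have hpow : ∀ j : Fin r, M ^ (j : ℕ) ∣ M ^ r := fun j => pow_dvd_pow M j.2.le
  have hd : ∀ (j : Fin r) (m y z : ℕ), m * y * z = 2 * K * L * P →
      m * (y * M ^ (j : ℕ)) ∣ 2 * K * L * P * M ^ r := by
    intro j m y z h
    rw [← mul_assoc]
    exact mul_dvd_mul ⟨z, h.symm⟩ (hpow j)
  unfold color
  refine Prod.ext (funext fun j => Prod.ext ?_ ?_) ?_
  · have := key K (1 * M ^ (j : ℕ)) (hd j K 1 (2 * L * P) (by ring))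
    simpa using this
  · have := key 2 (L * M ^ (j : ℕ)) (hd j 2 L (K * P) (by ring))
    simpa using this
  · dsimp only
    refine Finset.sum_congr rfl fun j _ => ?_
    have := key P (L * M ^ (j : ℕ)) (hd j P L (2 * K) (by ring))
    congr 1
    simpa using this

theorem abs_sub_floor_sq_le {P : ℕ} (hP : 0 < P) {z : ℝ} (h0 : 0 ≤ z) (h1 : z < 1) :
    0 ≤ z ^ 2 - (⌊(P : ℝ) * z⌋ : ℝ) ^ 2 / P ^ 2 ∧
      z ^ 2 - (⌊(P : ℝ) * z⌋ : ℝ) ^ 2 / P ^ 2 ≤ 2 / P := by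
  have hP' : (0 : ℝ) < P := by exact_mod_cast hP
  have e1 := Int.floor_le ((P : ℝ) * z)
  have e2 := Int.lt_floor_add_one ((P : ℝ) * z)
  have e3 : (0 : ℝ) ≤ ⌊(P : ℝ) * z⌋ := by exact_mod_cast Int.floor_nonneg.2 (by positivity)
  have e4 : z ^ 2 - (⌊(P : ℝ) * z⌋ : ℝ) ^ 2 / P ^ 2
      = (P * z - ⌊(P : ℝ) * z⌋) * (P * z + ⌊(P : ℝ) * z⌋) / P ^ 2 := by
    field_simp
    ring
  rw [e4]
  constructor
  · apply div_nonneg _ (by positivity)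
    exact mul_nonneg (by linarith) (by positivity)
  · rw [div_le_div_iff₀ (by positivity) hP']
    have : (P * z - ⌊(P : ℝ) * z⌋) * (P * z + ⌊(P : ℝ) * z⌋) ≤ 2 * P := by
      have h5 : P * z + (⌊(P : ℝ) * z⌋ : ℝ) ≤ 2 * P := by nlinarith
      nlinarith
    nlinarith

variable {k : ℕ} {a W : Fin k → ℤ}

/-- Equal coarse positions put `(a i₁ - a i₂) * M ^ j * Θ` within `1 / K` of an integer.
Multiplication by the quotient of `L` by `a i₁ - a i₂` makes the multiplier independent of the pair
and costs a factor of at most `L`. -/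
theorem exists_int_near_of_color {K L M H : ℕ} (hdvd : ∀ i j, i ≠ j → a i - a j ∣ (L : ℤ))
    (hL : 0 < L) (hH : 0 < H) (hK : K = 4 * H * L) {X Θ : ℝ} {i₁ i₂ : Fin k} (hne : i₁ ≠ i₂)
    {x : Fin k → ℝ} (hx : ∀ i, ∃ e : ℤ, x i = X + a i * Θ + e) (j : ℕ)
    (h : ⌊(K : ℝ) * Int.fract ((M : ℝ) ^ j * x i₁)⌋ = ⌊(K : ℝ) * Int.fract ((M : ℝ) ^ j * x i₂)⌋) :
    ∃ p : ℤ, |(L : ℝ) * (M : ℝ) ^ j * Θ - p| ≤ 1 / (4 * H) := by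
  obtain ⟨q, hq⟩ := hdvd i₁ i₂ hne
  obtain ⟨e₁, he₁⟩ := hx i₁
  obtain ⟨e₂, he₂⟩ := hx i₂
  have hLR : (0 : ℝ) < L := by exact_mod_cast hL
  have hHR : (0 : ℝ) < H := by exact_mod_cast hH
  have hKR : (K : ℝ) = 4 * H * L := by rw [hK]; push_cast; ring
  have hK0 : (0 : ℝ) < K := by rw [hKR]; positivity
  have h1 := Int.abs_sub_lt_one_of_floor_eq_floor h
  rw [← mul_sub, abs_mul, abs_of_pos hK0] at h1
  have hqR : (L : ℝ) = ((a i₁ : ℝ) - a i₂) * q := by exact_mod_cast hq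
  refine ⟨q * (⌊(M : ℝ) ^ j * x i₁⌋ - ⌊(M : ℝ) ^ j * x i₂⌋ - M ^ j * (e₁ - e₂)), ?_⟩
  have h2 : (L : ℝ) * (M : ℝ) ^ j * Θ - ((q * (⌊(M : ℝ) ^ j * x i₁⌋ - ⌊(M : ℝ) ^ j * x i₂⌋
      - M ^ j * (e₁ - e₂)) : ℤ) : ℝ)
      = q * (Int.fract ((M : ℝ) ^ j * x i₁) - Int.fract ((M : ℝ) ^ j * x i₂)) := by
    rw [Int.fract, Int.fract, hqR]
    push_cast
    have : ((a i₁ : ℝ) - a i₂) * Θ = x i₁ - x i₂ - (e₁ - e₂) := by rw [he₁, he₂]; ring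
    linear_combination (q : ℝ) * (M : ℝ) ^ j * this
  rw [h2, abs_mul]
  have hqL : |(q : ℝ)| ≤ L := by
    have h3 : |q| ≤ (L : ℤ) := by
      have h4 : (L : ℤ) = |a i₁ - a i₂| * |q| := by
        rw [← abs_mul, ← hq, Nat.abs_cast]
      have h5 : 1 ≤ |a i₁ - a i₂| := Int.one_le_abs fun h0 => by
        rw [h0, zero_mul] at hq
        omega
      nlinarith [abs_nonneg q]
    exact_mod_cast h3
  rw [le_div_iff₀ (by positivity)]
  calc |(q : ℝ)| * |Int.fract ((M : ℝ) ^ j * x i₁) - Int.fract ((M : ℝ) ^ j * x i₂)| * (4 * H)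
      ≤ L * |Int.fract ((M : ℝ) ^ j * x i₁) - Int.fract ((M : ℝ) ^ j * x i₂)| * (4 * H) := by
        gcongr
    _ = K * |Int.fract ((M : ℝ) ^ j * x i₁) - Int.fract ((M : ℝ) ^ j * x i₂)| := by
        rw [hKR]; ring
    _ ≤ 1 := h1.le

/-- Consecutive terms satisfy `τ (j + 1) - M * τ j ∈ ℤ`, and this integer has absolute value below
`1`. -/
theorem eq_pow_mul_of_near {M r : ℕ} (hM : 2 ≤ M) {τ : ℕ → ℝ} {p : ℕ → ℤ} {y : ℝ}
    (hτ : ∀ j < r, τ j = (M : ℝ) ^ j * y - p j) (hsmall : ∀ j < r, |τ j| ≤ 1 / (3 * M)) :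
    ∀ j < r, τ j = (M : ℝ) ^ j * τ 0 := by
  have hMR : (2 : ℝ) ≤ M := by exact_mod_cast hM
  intro j
  induction j with
  | zero => intro _; simp
  | succ j ih =>
    intro hj
    have h1 := ih (by omega)
    have h2 : τ (j + 1) - M * τ j = ((M * p j - p (j + 1) : ℤ) : ℝ) := by
      rw [hτ (j + 1) hj, hτ j (by omega)]
      push_cast
      ring
    have h3 : |τ (j + 1) - M * τ j| < 1 := by
      have e1 := hsmall (j + 1) hj
      have e2 := hsmall j (by omega)
      have e3 : |(M : ℝ) * τ j| ≤ 1 / 3 := by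
        rw [abs_mul, Nat.abs_cast]
        calc (M : ℝ) * |τ j| ≤ M * (1 / (3 * M)) := by gcongr
          _ = 1 / 3 := by field_simp
      have e4 : (1 : ℝ) / (3 * M) ≤ 1 / 3 := by
        rw [div_le_div_iff₀ (by positivity) (by norm_num)]
        linarith
      have := abs_sub (τ (j + 1)) (M * τ j)
      linarith
    have h4 : (M * p j - p (j + 1) : ℤ) = 0 := by
      rw [h2] at h3
      exact Int.abs_lt_one_iff.1 (by exact_mod_cast h3)
    rw [h4, Int.cast_zero, sub_eq_zero] at h2
    rw [h2, h1]
    ring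

/-- A progression whose colours satisfy the linear equation has a small common difference. -/
theorem near_int_of_color {K L P M H r : ℕ} (hk : 0 < k) (ha : StrictMono a)
    (hsym : Odd k ∨ ¬ IsSymmetric a) (hW : IsWeight a W)
    (hdvd : ∀ i j, i ≠ j → a i - a j ∣ (L : ℤ)) (hdiff : ∀ i j, |a i - a j| ≤ H)
    (hL : 0 < L) (hH : 0 < H) (hK : K = 4 * H * L) (hM : 2 ≤ M) (hr : 0 < r)
    (hP : P = 36 * r * M ^ 2) {X Θ : ℝ} {x : Fin k → ℝ}
    (hx : ∀ i, ∃ e : ℤ, x i = X + a i * Θ + e)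
    (hc : ∀ φ : (Fin r → ℤ × ℤ) × ℤ → ℝ, ∑ i, (W i : ℝ) * φ (color K L P M r (x i)) = 0) :
    ∃ e : ℤ, |(L : ℝ) * Θ - e| ≤ 1 / (3 * (M : ℝ) ^ r) := by
  have hMR : (2 : ℝ) ≤ M := by exact_mod_cast hM
  have hHR : (0 : ℝ) < H := by exact_mod_cast hH
  have hrR : (0 : ℝ) < r := by exact_mod_cast hr
  have hPR : (P : ℝ) = 36 * r * M ^ 2 := by rw [hP]; push_cast; ring
  have hP0 : 0 < P := by rw [hP]; positivity
  have hPR0 : (0 : ℝ) < P := by exact_mod_cast hP0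
  set i₀ : Fin k := ⟨0, hk⟩
  obtain ⟨i₁, hne, hcol⟩ := exists_ne_color_eq hW.ne_zero hc i₀
  have hnear : ∀ j : Fin r, ∃ p : ℤ, |(L : ℝ) * (M : ℝ) ^ (j : ℕ) * Θ - p| ≤ 1 / (4 * H) :=
    fun j => exists_int_near_of_color hdvd hL hH hK hne hx j
      (congrArg Prod.fst (congrFun (congrArg Prod.fst hcol) j))
  choose p hp using hnear
  set τ : Fin r → ℝ := fun j => (L : ℝ) * (M : ℝ) ^ (j : ℕ) * Θ - p j with hτ
  set z : Fin r → ℝ := fun j => Int.fract ((L : ℝ) * (M : ℝ) ^ (j : ℕ) * x i₀) with hz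
  have hfr : ∀ (j : Fin r) (i : Fin k), Int.fract ((L : ℝ) * (M : ℝ) ^ (j : ℕ) * x i)
      = Int.fract (z j + ((a i : ℝ) - a i₀) * τ j) := by
    intro j i
    obtain ⟨e, he⟩ := hx i
    obtain ⟨e₀, he₀⟩ := hx i₀
    rw [Int.fract_eq_fract]
    refine ⟨⌊(L : ℝ) * (M : ℝ) ^ (j : ℕ) * x i₀⌋ + (a i - a i₀) * p j
      + L * M ^ (j : ℕ) * (e - e₀), ?_⟩
    simp only [hz, hτ, Int.fract]
    rw [he, he₀]
    push_cast
    ring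
  have hval : ∀ (j : Fin r) (i : Fin k), Int.fract ((L : ℝ) * (M : ℝ) ^ (j : ℕ) * x i)
      = z j + ((a i : ℝ) - a i₀) * τ j := by
    intro j i
    rw [hfr j i]
    refine fract_eq_of_color hW ha hc i₀ (Int.fract_nonneg _) (Int.fract_lt_one _) (fun i => ?_)
      (g := fun c => (c.1 j).2) (fun i => ?_) i
    · have h1 : |(a i : ℝ) - a i₀| ≤ H := by exact_mod_cast hdiff i i₀
      rw [abs_mul]
      calc |(a i : ℝ) - a i₀| * |τ j| ≤ H * (1 / (4 * H)) := by
            gcongr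
            exact hp j
        _ = 1 / 4 := by field_simp
    · rw [← hfr j i]
      rfl
  -- Without wraparound the squared length is a quadratic in `a i` with leading coefficient `∑ τ j ^
  -- 2`, known from the colour up to `2 * r / P`. The choice `P = 36 * r * M ^ 2` turns the bound
  -- into `(1 / (3 * M)) ^ 2`.
  have hquad : ∑ j, τ j ^ 2 ≤ 2 * (2 * r / P) := by
    refine quadratic_coeff_le hk ha hsym hW.ne_zero hc
      (A := ∑ j, (z j - a i₀ * τ j) ^ 2) (B := ∑ j, 2 * (z j - a i₀ * τ j) * τ j)
      fun i i' hii => ?_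
    have hQ : ∀ i, (∑ j, (z j - a i₀ * τ j) ^ 2) + (∑ j, 2 * (z j - a i₀ * τ j) * τ j) * a i
        + (∑ j, τ j ^ 2) * (a i : ℝ) ^ 2
        = ∑ j : Fin r, Int.fract ((L : ℝ) * (M : ℝ) ^ (j : ℕ) * x i) ^ 2 := by
      intro i
      rw [Finset.sum_mul, Finset.sum_mul, ← Finset.sum_add_distrib, ← Finset.sum_add_distrib]
      refine Finset.sum_congr rfl fun j _ => ?_
      rw [hval j i]
      ring
    have hround : ∀ i, 0 ≤ ∑ j : Fin r, Int.fract ((L : ℝ) * (M : ℝ) ^ (j : ℕ) * x i) ^ 2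
        - ((color K L P M r (x i)).2 : ℝ) / P ^ 2 ∧
        ∑ j : Fin r, Int.fract ((L : ℝ) * (M : ℝ) ^ (j : ℕ) * x i) ^ 2
        - ((color K L P M r (x i)).2 : ℝ) / P ^ 2 ≤ 2 * r / P := by
      intro i
      have h1 : ((color K L P M r (x i)).2 : ℝ) / P ^ 2 = ∑ j : Fin r,
          (⌊(P : ℝ) * Int.fract ((L : ℝ) * (M : ℝ) ^ (j : ℕ) * x i)⌋ : ℝ) ^ 2 / P ^ 2 := by
        rw [← Finset.sum_div]
        simp [color]
      rw [h1, ← Finset.sum_sub_distrib]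
      constructor
      · exact Finset.sum_nonneg fun j _ =>
          (abs_sub_floor_sq_le hP0 (Int.fract_nonneg _) (Int.fract_lt_one _)).1
      · refine (Finset.sum_le_sum fun j _ =>
          (abs_sub_floor_sq_le hP0 (Int.fract_nonneg _) (Int.fract_lt_one _)).2).trans ?_
        rw [Finset.sum_const, Finset.card_univ, Fintype.card_fin, nsmul_eq_mul]
        exact le_of_eq (by ring)
    rw [hQ, hQ, abs_le]
    have e1 := hround i
    have e2 := hround i'
    rw [← hii] at e2
    constructor <;> linarith [e1.1, e1.2, e2.1, e2.2]
  have hsmall : ∀ j, |τ j| ≤ 1 / (3 * M) := by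
    intro j
    refine abs_le_of_sq_le_sq ?_ (by positivity)
    calc τ j ^ 2 ≤ ∑ j, τ j ^ 2 :=
          Finset.single_le_sum (f := fun j => τ j ^ 2) (fun j _ => sq_nonneg _) (Finset.mem_univ j)
      _ ≤ 2 * (2 * r / P) := hquad
      _ = (1 / (3 * M)) ^ 2 := by
          rw [hPR]
          field_simp
          norm_num
  have hpow := eq_pow_mul_of_near (r := r) hM (y := L * Θ)
    (τ := fun j => if h : j < r then τ ⟨j, h⟩ else 0) (p := fun j => if h : j < r then p ⟨j, h⟩ else 0)
    (fun j hj => by simp only [hj, dif_pos, hτ]; ring)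
    (fun j hj => by simp only [hj, dif_pos]; exact hsmall _) (r - 1) (by omega)
  simp only [show r - 1 < r by omega, hr, dif_pos] at hpow
  refine ⟨p ⟨0, hr⟩, ?_⟩
  have h0 : (L : ℝ) * Θ - p ⟨0, hr⟩ = τ ⟨0, hr⟩ := by simp [hτ]
  -- The last step is `M ^ (r - 1)` times the first, yet it is still at most `1 / (3 * M)`.
  have h1 := hsmall ⟨r - 1, by omega⟩
  rw [hpow, abs_mul, abs_pow, Nat.abs_cast] at h1
  rw [h0, le_div_iff₀ (by positivity)]
  rw [le_div_iff₀ (by positivity)] at h1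
  calc |τ ⟨0, hr⟩| * (3 * (M : ℝ) ^ r) = (M : ℝ) ^ (r - 1) * |τ ⟨0, hr⟩| * (3 * M) := by
        obtain ⟨q, rfl⟩ : ∃ q, r = q + 1 := ⟨r - 1, by omega⟩
        rw [Nat.add_sub_cancel, pow_succ]
        ring
    _ ≤ 1 := h1

end Coloring

/-! ### Counting patterns in the phase set -/

section Density

variable {N k : ℕ} {a W : Fin k → ℤ}

/-- The annihilated powers give `q * T + E ≡ 0` modulo `N`, where `T` is the weighted sum of codes
and `E` collects the offsets inside the intervals. The left side is too small to wrap around, and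
`|E| < q` forces `T = 0`. -/
theorem sum_code_eq_zero [NeZero N] (hW : IsWeight a W) {s m q w Y : ℕ} (hs : s + 2 ≤ k)
    (hw : ∑ i, |W i| ≤ w) {σ : Fin k → ℕ} (hσ : ∀ i, σ i ≤ Y) (hmq : w * m < q)
    (hqN : q * (w * Y + 1) ≤ N) {n d : ZMod N}
    (h : ∀ i, ((n + a i • d) ^ s - ((q * σ i : ℕ) : ZMod N)).val < m) :
    ∑ i, W i * (σ i : ℤ) = 0 := by
  set e : Fin k → ℕ := fun i => ((n + a i • d) ^ s - ((q * σ i : ℕ) : ZMod N)).val with he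
  have hpoly : ∑ i, (W i : ZMod N) * (n + a i • d) ^ s = 0 := by
    have h1 := congrArg (fun z : ℤ => (z : ZMod N)) (hW.sum_pow hs (n.val : ℤ) (d.val : ℤ))
    simp only [Int.cast_sum, Int.cast_mul, Int.cast_pow, Int.cast_add, Int.cast_natCast,
      ZMod.natCast_zmod_val, Int.cast_zero] at h1
    simpa only [zsmul_eq_mul] using h1
  have hsplit : ∀ i, (n + a i • d) ^ s = (q : ZMod N) * σ i + e i := by
    intro i
    rw [he, ZMod.natCast_zmod_val]
    push_cast
    ring
  set T := ∑ i, W i * (σ i : ℤ) with hT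
  set E := ∑ i, W i * (e i : ℤ) with hE
  have hdvd : (N : ℤ) ∣ q * T + E := by
    rw [← ZMod.intCast_zmod_eq_zero_iff_dvd]
    simp_rw [hsplit] at hpoly
    rw [← hpoly, hT, hE]
    push_cast
    rw [Finset.mul_sum, ← Finset.sum_add_distrib]
    exact Finset.sum_congr rfl fun i _ => by ring
  have hTle : |T| ≤ (w : ℤ) * Y := by
    refine (abs_sum_weight_mul_le W (y := (Y : ℤ)) fun i => ?_).trans ?_
    · rw [Nat.abs_cast]; exact_mod_cast hσ i
    · gcongr
  have hEle : |E| < q := by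
    refine lt_of_le_of_lt (b := (w : ℤ) * m) ?_ (by exact_mod_cast hmq)
    refine (abs_sum_weight_mul_le W (y := (m : ℤ)) fun i => ?_).trans ?_
    · rw [Nat.abs_cast]; exact_mod_cast (h i).le
    · gcongr
  have hqN' : (q : ℤ) * (w * Y + 1) ≤ N := by exact_mod_cast hqN
  have hzero : (q : ℤ) * T + E = 0 := by
    refine Int.eq_zero_of_abs_lt_dvd hdvd ?_
    have h1 : |(q : ℤ) * T + E| ≤ q * |T| + |E| := by
      refine (abs_add_le _ _).trans ?_
      rw [abs_mul, Nat.abs_cast]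
    have h2 : (q : ℤ) * |T| ≤ q * (w * Y) := by gcongr
    linarith
  by_contra hT0
  have h1 : 1 ≤ |T| := Int.one_le_abs hT0
  have h2 : (q : ℤ) * |T| = |E| := by
    rw [← Nat.abs_cast q, ← abs_mul, show (q : ℤ) * T = -E by linarith, abs_neg]
  have h3 : (0 : ℤ) ≤ q := Int.natCast_nonneg q
  nlinarith

/-- If all common differences of patterns in `A` are nearly integral after scaling, then there are
few patterns in `A`. -/
theorem patternDensity_le_of_near (hN : N.Prime) [NeZero N] {L Q : ℕ} (hL : 0 < L) (hLN : L < N)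
    (hQ : 0 < Q) (hQN : 3 * Q ≤ N) {A : Set (ZMod N)}
    (h : ∀ n d : ZMod N, (∀ i, n + a i • d ∈ A) →
      ∃ e : ℤ, |(L : ℝ) * ((d.val : ℝ) / N) - e| ≤ 1 / (3 * Q)) :
    patternDensity a A ≤ 1 / Q := by
  classical
  have := Fact.mk hN
  have hNR : (0 : ℝ) < N := by exact_mod_cast hN.pos
  have hQR : (0 : ℝ) < Q := by exact_mod_cast hQ
  set D : Finset (ZMod N) := Finset.univ.filter fun d =>
    ∃ e : ℤ, |(L : ℝ) * ((d.val : ℝ) / N) - e| ≤ 1 / (3 * Q) with hD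
  have hD' : ∀ d ∈ D, ∃ e : ℤ, |(L : ℝ) * ((d.val : ℝ) / N) - e| ≤ 1 / (3 * Q) := fun d hd =>
    (Finset.mem_filter.1 hd).2
  choose! e he using hD'
  have hcard : (D.card : ℝ) ≤ N / Q := by
    set t : ℤ := ⌊(N : ℝ) / (3 * Q)⌋ with ht
    have ht0 : 0 ≤ t := Int.floor_nonneg.2 (by positivity)
    -- Since `L` is invertible modulo `N`, `d` is recovered from the small integer `L * d - e * N`.
    have h1 : D.card ≤ (Finset.Icc (-t) t).card := by
      refine Finset.card_le_card_of_injOn (fun d => (L : ℤ) * d.val - e d * N) (fun d hd => ?_)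
        fun d hd d' hd' hdd => ?_
      · have h2 := he d hd
        have h3 : |(((L : ℤ) * d.val - e d * N : ℤ) : ℝ)| ≤ N / (3 * Q) := by
          have : (((L : ℤ) * d.val - e d * N : ℤ) : ℝ)
              = ((L : ℝ) * ((d.val : ℝ) / N) - e d) * N := by
            push_cast
            field_simp
          rw [this, abs_mul, abs_of_pos hNR]
          calc _ ≤ 1 / (3 * (Q : ℝ)) * N := by gcongr
            _ = _ := by ring
        rw [abs_le] at h3
        rw [Finset.coe_Icc, Set.mem_Icc]
        constructor
        · rw [neg_le, ht]
          exact Int.le_floor.2 (by push_cast at h3 ⊢; linarith [h3.1])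
        · exact Int.le_floor.2 h3.2
      · have h2 := congrArg (fun z : ℤ => (z : ZMod N)) hdd
        simp only [Int.cast_sub, Int.cast_mul, Int.cast_natCast, ZMod.natCast_zmod_val,
          ZMod.natCast_self, mul_zero, sub_zero] at h2
        refine mul_left_cancel₀ ?_ h2
        rw [Ne, ZMod.natCast_eq_zero_iff]
        exact fun hdvd => absurd (Nat.le_of_dvd hL hdvd) (by omega)
    rw [Int.card_Icc] at h1
    have h2 : (D.card : ℝ) ≤ 2 * t + 1 := by
      have : (D.card : ℤ) ≤ 2 * t + 1 := by omega
      exact_mod_cast this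
    have h3 : (t : ℝ) ≤ N / (3 * Q) := Int.floor_le _
    have h4 : (1 : ℝ) ≤ N / (3 * Q) := by
      rw [le_div_iff₀ (by positivity), one_mul]
      exact_mod_cast hQN
    calc (D.card : ℝ) ≤ 3 * (N / (3 * Q)) := by linarith
      _ = N / Q := by field_simp
  have hle : ∀ n d : ZMod N, ∏ i, A.indicator (1 : ZMod N → ℝ) (n + a i • d)
      ≤ if d ∈ D then 1 else 0 := by
    intro n d
    by_cases hA : ∀ i, n + a i • d ∈ A
    · rw [if_pos (Finset.mem_filter.2 ⟨Finset.mem_univ d, h n d hA⟩)]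
      refine Finset.prod_le_one (fun i _ => ?_) fun i _ => ?_
      · exact Set.indicator_nonneg (fun _ _ => zero_le_one) _
      · exact Set.indicator_le_self' (by simp) _
    · push Not at hA
      obtain ⟨i, hi⟩ := hA
      rw [Finset.prod_eq_zero (Finset.mem_univ i) (Set.indicator_of_notMem hi _)]
      split_ifs <;> norm_num
  calc patternDensity a A ≤ 𝔼 _n : ZMod N, 𝔼 d : ZMod N, (if d ∈ D then (1 : ℝ) else 0) :=
        Finset.expect_le_expect fun n _ => Finset.expect_le_expect fun d _ => hle n d
    _ = (D.card : ℝ) / N := by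
        rw [Fintype.expect_const, Fintype.expect_eq_sum_div_card, ZMod.card]
        simp
    _ ≤ N / Q / N := by gcongr
    _ = 1 / Q := by field_simp

/-- The phase set built from a colouring contains few patterns. -/
theorem exists_phaseSet_patternDensity_le (hk : 0 < k) (ha : StrictMono a)
    (hsym : Odd k ∨ ¬ IsSymmetric a) (hW : IsWeight a W) {s L K P M H r w Y : ℕ}
    (hs : s + 2 ≤ k) (hw : ∑ i, |W i| ≤ w)
    (hdvd : ∀ i j, i ≠ j → a i - a j ∣ (L : ℤ)) (hdiff : ∀ i j, |a i - a j| ≤ H)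
    (hL : 0 < L) (hH : 0 < H) (hK : K = 4 * H * L) (hM : 2 ≤ M) (hr : 0 < r)
    (hP : P = 36 * r * M ^ 2)
    (hY : Y = k * ((colorSet K P r).card * (w * (colorSet K P r).card ^ k + 1)) ^ k)
    {α : ℝ} (hα : 0 < α) (hαY : α * (2 * w * (w * Y + 1)) ≤ 1) :
    ∃ N₀ : ℕ, ∀ (N : ℕ) [NeZero N], N.Prime → N₀ ≤ N → ∃ τ : ℕ → ZMod N,
      patternDensity a (phaseSet s ⌊α * N⌋₊ (2 * K * L * P * M ^ r) τ) ≤ 1 / (M : ℝ) ^ r := by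
  obtain ⟨σ, hσ, hcode⟩ := exists_code (colorSet K P r) W hw
  rw [← hY] at hσ
  have hK0 : 0 < K := by rw [hK]; positivity
  have hM0 : 0 < M := by omega
  have hP0 : 0 < P := by rw [hP]; positivity
  refine ⟨L + 1 + 3 * M ^ r + 2 * (w * Y + 1) + 1, fun N _ hN hN0 => ?_⟩
  have hNR : (0 : ℝ) < N := by exact_mod_cast hN.pos
  set q := N / (w * Y + 1) with hq
  set M' := 2 * K * L * P * M ^ r with hM'
  refine ⟨fun b => ((q * σ (color K L P M r ((b : ℝ) / M')) : ℕ) : ZMod N), ?_⟩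
  have hden := patternDensity_le_of_near (a := a) hN hL (by omega) (Q := M ^ r) (by positivity)
    (by omega) (A := phaseSet s ⌊α * N⌋₊ M'
      fun b => ((q * σ (color K L P M r ((b : ℝ) / M')) : ℕ) : ZMod N)) ?_
  · exact_mod_cast hden
  intro n d hA
  set x : Fin k → ℝ := fun i => ((n + a i • d).val : ℝ) / N with hx
  have hcol : ∀ i, color K L P M r (((M' * (n + a i • d).val / N : ℕ) : ℝ) / M')
      = color K L P M r (x i) := fun i => (color_block hK0 hL hP0 hM0 _ _).symm
  have hA' : ∀ i, ((n + a i • d) ^ s - ((q * σ (color K L P M r (x i)) : ℕ) : ZMod N)).val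
      < ⌊α * N⌋₊ := by
    intro i
    have := hA i
    rw [phaseSet, Set.mem_ofPred_eq, hcol i] at this
    exact this
  -- The factor `2` in `hαY` absorbs the rounding of `q`, which loses less than half of `N / (w * Y
  -- + 1)`.
  have hmq : w * ⌊α * N⌋₊ < q := by
    have h1 : (⌊α * N⌋₊ : ℝ) ≤ α * N := Nat.floor_le (by positivity)
    have hb : (0 : ℝ) < (w * Y + 1 : ℕ) := by positivity
    have h2 : (N : ℝ) / (w * Y + 1 : ℕ) - 1 < q := by
      rw [hq, ← Nat.floor_div_eq_div (K := ℝ)]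
      linarith [Nat.lt_floor_add_one ((N : ℝ) / (w * Y + 1 : ℕ))]
    have h3 : (2 : ℝ) ≤ (N : ℝ) / (w * Y + 1 : ℕ) := by
      rw [le_div_iff₀ hb]
      exact_mod_cast (by omega)
    have h4 : (w : ℝ) * (α * N) ≤ (N : ℝ) / (w * Y + 1 : ℕ) / 2 := by
      rw [le_div_iff₀ (by norm_num), le_div_iff₀ hb]
      push_cast
      calc (w : ℝ) * (α * N) * 2 * (w * Y + 1) = α * (2 * w * (w * Y + 1)) * N := by ring
        _ ≤ 1 * N := by gcongr
        _ = N := one_mul _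
    have h5 : (w : ℝ) * ⌊α * N⌋₊ ≤ w * (α * N) := by gcongr
    have : ((w * ⌊α * N⌋₊ : ℕ) : ℝ) < q := by
      push_cast
      linarith
    exact_mod_cast this
  have hzero := sum_code_eq_zero hW hs hw (fun i => hσ _ (color_mem hK0 hP0 (x i))) hmq
    (Nat.div_mul_le_self N (w * Y + 1)) hA'
  have hall := hcode (fun i => color K L P M r (x i)) (fun i => color_mem hK0 hP0 (x i)) hzero
  have hprog : ∀ i, ∃ e : ℤ, x i = (n.val : ℝ) / N + a i * ((d.val : ℝ) / N) + e := by
    intro i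
    have h1 : ((((n + a i • d).val : ℤ) - (n.val + a i * d.val) : ℤ) : ZMod N) = 0 := by
      push_cast
      rw [ZMod.natCast_zmod_val, ZMod.natCast_zmod_val, ZMod.natCast_zmod_val, zsmul_eq_mul,
        sub_self]
    obtain ⟨e, he⟩ := (ZMod.intCast_zmod_eq_zero_iff_dvd _ N).1 h1
    refine ⟨e, ?_⟩
    have h2 : ((n + a i • d).val : ℝ) - (n.val + a i * d.val) = N * e := by exact_mod_cast he
    simp only [hx]
    field_simp
    linarith
  have := near_int_of_color hk ha hsym hW hdvd hdiff hL hH hK hM hr hP hprog hall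
  exact_mod_cast this

end Density

/-! ### Choice of parameters -/

section Main

variable {k : ℕ} {a : Fin k → ℤ}

theorem patternDensity_nonneg {G : Type*} [AddCommGroup G] [Fintype G] (a : Fin k → ℤ)
    (A : Set G) : 0 ≤ patternDensity a A :=
  Finset.expect_nonneg fun _ _ => Finset.expect_nonneg fun _ _ =>
    Finset.prod_nonneg fun _ _ => Set.indicator_nonneg (fun _ _ => zero_le_one) _

theorem zero_mem_lowerBounds (a : Fin k → ℤ) (α : ℝ) : (0 : ℝ) ∈ lowerBounds a α := fun ε hε =>
  ⟨1, one_pos, 0, fun _ _ _ A _ => by linarith [patternDensity_nonneg a A]⟩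

/-- The slack `ε` in the definition makes the set closed: half of it pays for approximating the
supremum. -/
theorem isGreatest_rho {α : ℝ} (hbdd : BddAbove (lowerBounds a α)) :
    IsGreatest (lowerBounds a α) (rho a α) := by
  refine ⟨fun ε hε => ?_, fun ρ hρ => le_csSup hbdd hρ⟩
  obtain ⟨ρ, hρ, hlt⟩ := exists_lt_of_lt_csSup ⟨0, zero_mem_lowerBounds a α⟩
    (show sSup (lowerBounds a α) - ε / 2 < sSup (lowerBounds a α) by linarith)
  obtain ⟨η, hη, N₀, h⟩ := hρ (ε / 2) (by linarith)
  refine ⟨η, hη, N₀, fun N _ hN A hA => ?_⟩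
  have := h N hN A hA
  unfold rho
  linarith

/-- Uniform sets with few patterns bound the elements of `lowerBounds`. -/
theorem le_of_mem_lowerBounds {α b : ℝ}
    (h : ∀ η : ℝ, 0 < η → ∀ N₀ : ℕ, ∃ (N : ℕ) (_ : NeZero N), N₀ ≤ N ∧ ∃ A : Set (ZMod N),
      gowersNorm (k - 2) (fun n => A.indicator (1 : ZMod N → ℂ) n - (α : ℂ)) ≤ η ∧
      patternDensity a A ≤ b + η) {ρ : ℝ} (hρ : ρ ∈ lowerBounds a α) : ρ ≤ b := by
  refine le_of_forall_pos_le_add fun ε hε => ?_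
  obtain ⟨η, hη, N₀, h1⟩ := hρ (ε / 2) (by linarith)
  obtain ⟨N, _, hN, A, hA, hb⟩ := h (min η (ε / 2)) (lt_min hη (by linarith)) N₀
  have h2 := h1 N hN A (hA.trans (min_le_left _ _))
  have h3 := min_le_right η (ε / 2)
  linarith

/-- A phase set with a single block suffices. The bound shows that the supremum is finite, and it
settles those `α` that are not small. -/
theorem le_of_mem_lowerBounds_of_lt_one (hk : 4 ≤ k) {α ρ : ℝ} (hα : 0 < α) (hα1 : α < 1)
    (hρ : ρ ∈ lowerBounds a α) : ρ ≤ α := by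
  refine le_of_mem_lowerBounds (fun η hη N₀ => ?_) hρ
  obtain ⟨N₁, h⟩ := phaseSet_uniform (s := k - 3) (M := 1) (by omega) hα hα1 one_pos hη
  obtain ⟨N, hN, hNp⟩ := Nat.exists_infinite_primes (max N₀ N₁)
  have : NeZero N := ⟨hNp.ne_zero⟩
  obtain ⟨h1, h2⟩ := h N hNp ((le_max_right _ _).trans hN) 0
  refine ⟨N, this, (le_max_left _ _).trans hN, _, ?_, h2 k a (by omega)⟩
  rwa [show k - 2 = k - 3 + 1 by omega]

theorem exists_difference_bound (a : Fin k → ℤ) :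
    ∃ H : ℕ, 0 < H ∧ ∀ i j, |a i - a j| ≤ H := by
  refine ⟨(∑ p : Fin k × Fin k, (a p.1 - a p.2).natAbs) + 1, by omega, fun i j => ?_⟩
  have := Finset.single_le_sum (f := fun p : Fin k × Fin k => (a p.1 - a p.2).natAbs)
    (fun _ _ => Nat.zero_le _) (Finset.mem_univ (i, j))
  rw [Int.abs_eq_natAbs]
  simp only at this
  exact_mod_cast this.trans (Nat.le_succ _)

/-- With `M = 2 ^ r` the rounded squared length has only exponentially many values in `r`, as `r ^ 3
* (2 ^ r) ^ 4 ≤ 128 ^ r`. -/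
theorem card_colorSet_le {K r : ℕ} (hr : 0 < r) :
    (colorSet K (36 * r * (2 ^ r) ^ 2) r).card ≤ (K * 2 * (1297 * 128)) ^ r := by
  rw [card_colorSet, mul_pow (K * 2) (1297 * 128) r]
  gcongr
  have h1 : r ≤ 2 ^ r := Nat.lt_two_pow_self.le
  calc r * (36 * r * (2 ^ r) ^ 2) ^ 2 + 1 = 1296 * (r ^ 3 * (2 ^ r) ^ 4) + 1 := by ring
    _ ≤ 1296 * ((2 ^ r) ^ 3 * (2 ^ r) ^ 4) + (2 ^ r) ^ 3 * (2 ^ r) ^ 4 := by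
        gcongr
        exact Nat.one_le_iff_ne_zero.2 (by positivity)
    _ = 1297 * 128 ^ r := by
        rw [show (128 : ℕ) = 2 ^ 7 by norm_num, ← pow_mul, ← pow_mul, ← pow_mul]
        ring
    _ ≤ 1297 ^ r * 128 ^ r := by
        gcongr
        exact Nat.le_self_pow hr.ne' 1297
    _ = (1297 * 128) ^ r := (mul_pow _ _ _).symm

/-- The code range is polynomial in the number of colours, with degree depending only on `k`, so
exponential growth in `r` is preserved. -/
theorem code_bound_le {k w R R₀ r : ℕ} (hk : 0 < k) (hr : 0 < r) (hR : 0 < R) (hw : 0 < w)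
    (hR₀ : R ≤ R₀ ^ r) :
    2 * w * (w * (k * (R * (w * R ^ k + 1)) ^ k) + 1)
      ≤ (2 * w * (w + 1) * k * (w + 1) ^ k * R₀ ^ ((k + 1) * k)) ^ r := by
  have h1 : k * (R * (w * R ^ k + 1)) ^ k ≤ k * (w + 1) ^ k * (R₀ ^ r) ^ ((k + 1) * k) := by
    calc k * (R * (w * R ^ k + 1)) ^ k ≤ k * (R * (w * R ^ k + R ^ k)) ^ k := by
          gcongr
          exact Nat.one_le_pow _ _ hR
      _ = k * (w + 1) ^ k * R ^ ((k + 1) * k) := by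
          rw [pow_mul, mul_assoc, ← mul_pow]
          congr 2
          ring
      _ ≤ _ := by gcongr
  have hR₀' : 0 < R₀ ^ r := hR.trans_le hR₀
  have hpos : 1 ≤ k * (w + 1) ^ k * (R₀ ^ r) ^ ((k + 1) * k) :=
    Nat.one_le_iff_ne_zero.2 (by positivity)
  calc 2 * w * (w * (k * (R * (w * R ^ k + 1)) ^ k) + 1)
      ≤ 2 * w * (w * (k * (w + 1) ^ k * (R₀ ^ r) ^ ((k + 1) * k))
        + k * (w + 1) ^ k * (R₀ ^ r) ^ ((k + 1) * k)) := by gcongr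
    _ = (2 * w * (w + 1) * k * (w + 1) ^ k) * (R₀ ^ r) ^ ((k + 1) * k) := by ring
    _ ≤ (2 * w * (w + 1) * k * (w + 1) ^ k) ^ r * (R₀ ^ r) ^ ((k + 1) * k) := by
        gcongr
        exact Nat.le_self_pow hr.ne' _
    _ = _ := by rw [mul_pow _ (R₀ ^ ((k + 1) * k)) r, ← pow_mul, ← pow_mul, mul_comm r]

/-- At density `D ^ (-r)` there are uniform sets with pattern density about `2 ^ (-r ^ 2)`. -/
theorem exists_le_of_mem_lowerBounds (hk : 4 ≤ k) (ha : StrictMono a)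
    (hsym : Odd k ∨ ¬ IsSymmetric a) :
    ∃ D : ℕ, 2 ≤ D ∧ ∀ r : ℕ, 0 < r → ∀ α : ℝ, 0 < α → α < 1 → α * (D : ℝ) ^ r ≤ 1 →
      ∀ ρ ∈ lowerBounds a α, ρ ≤ 1 / ((2 : ℝ) ^ r) ^ r := by
  obtain ⟨W, hW⟩ := exists_isWeight (by omega : 1 ≤ k) ha
  obtain ⟨H, hH, hdiff⟩ := exists_difference_bound a
  obtain ⟨w, hw0, hw⟩ : ∃ w : ℕ, 0 < w ∧ ∑ i, |W i| ≤ w := by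
    refine ⟨(∑ i, |W i|).toNat + 1, by omega, ?_⟩
    have := Int.self_le_toNat (∑ i, |W i|)
    push_cast
    linarith
  set L := H.factorial with hL
  have hL0 : 0 < L := H.factorial_pos
  have hdvd : ∀ i j, i ≠ j → a i - a j ∣ (L : ℤ) := by
    intro i j hij
    rw [← Int.natAbs_dvd_natAbs, Int.natAbs_natCast]
    refine Nat.dvd_factorial (Int.natAbs_pos.2 (sub_ne_zero.2 fun h => hij (ha.injective h))) ?_
    have := hdiff i j
    rw [Int.abs_eq_natAbs] at this
    exact_mod_cast this
  set K := 4 * H * L with hK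
  have hK0 : 0 < K := by positivity
  set R₀ := K * 2 * (1297 * 128) with hR₀
  refine ⟨2 * w * (w + 1) * k * (w + 1) ^ k * R₀ ^ ((k + 1) * k), ?_, ?_⟩
  · have h1 : 0 < w * (w + 1) * k * (w + 1) ^ k * R₀ ^ ((k + 1) * k) := by
      have : 0 < k := by omega
      positivity
    calc 2 ≤ 2 * (w * (w + 1) * k * (w + 1) ^ k * R₀ ^ ((k + 1) * k)) := by omega
      _ = _ := by ring
  intro r hr α hα hα1 hαD ρ hρ
  have hM : 2 ≤ 2 ^ r := Nat.le_self_pow hr.ne' 2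
  set P := 36 * r * (2 ^ r) ^ 2 with hP
  have hP0 : 0 < P := by positivity
  have hR : 0 < (colorSet K P r).card := Finset.card_pos.2 ⟨_, color_mem (L := L) (M := 2) hK0 hP0 0⟩
  have hbound := code_bound_le (by omega : 0 < k) hr hR hw0 (card_colorSet_le (K := K) hr)
  have hαY : α * (2 * w * (w * (k * ((colorSet K P r).card *
      (w * (colorSet K P r).card ^ k + 1)) ^ k : ℕ) + 1)) ≤ 1 := by
    refine le_trans ?_ hαD
    gcongr
    exact_mod_cast hbound
  obtain ⟨N₁, h1⟩ := exists_phaseSet_patternDensity_le (by omega : 0 < k) ha hsym hW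
    (s := k - 2) (by omega) hw hdvd hdiff hL0 hH hK hM hr hP rfl hα hαY
  refine le_of_mem_lowerBounds (fun η hη N₀ => ?_) hρ
  obtain ⟨N₂, h2⟩ := phaseSet_uniform (s := k - 3) (M := 2 * K * L * P * (2 ^ r) ^ r) (by omega)
    hα hα1 (by positivity) hη
  obtain ⟨N, hN, hNp⟩ := Nat.exists_infinite_primes (max N₀ (max N₁ N₂))
  have hNe : NeZero N := ⟨hNp.ne_zero⟩
  obtain ⟨τ, hτ⟩ := h1 N hNp (((le_max_left _ _).trans (le_max_right _ _)).trans hN)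
  obtain ⟨h3, -⟩ := h2 N hNp (((le_max_right _ _).trans (le_max_right _ _)).trans hN) τ
  rw [← show k - 2 = k - 3 + 1 by omega] at h3
  refine ⟨N, hNe, (le_max_left _ _).trans hN, _, h3, hτ.trans ?_⟩
  push_cast
  linarith

end Main

end PatternAP

end

/-- Here `IsGreatest` says that the largest real number defining `ρ_a(α)` exists and is
`rho a α`, so that the bound is not about a default value of a supremum. -/
theorem mainTheorem6 (k : ℕ) (hk : 4 ≤ k) (a : Fin k → ℤ) (ha : StrictMono a)
    (hsym : Odd k ∨ ¬ PatternAP.IsSymmetric a) :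
    ∃ c : ℝ, 0 < c ∧ ∀ α : ℝ, 0 < α → α < 1 / 2 →
      IsGreatest (PatternAP.lowerBounds a α) (PatternAP.rho a α) ∧
      PatternAP.rho a α < α ^ (c * Real.log (1 / α)) := by
  obtain ⟨D, hD, hbound⟩ := PatternAP.exists_le_of_mem_lowerBounds hk ha hsym
  have hDR : (2 : ℝ) ≤ D := by exact_mod_cast hD
  set l := Real.log D with hl
  have hl0 : 0 < l := Real.log_pos (by linarith)
  have h2 : 0 < Real.log 2 := Real.log_pos one_lt_two
  -- The first bound serves `α ≤ 1 / D`: there `r ≥ t / (2 * l)`, so `r ^ 2 * log 2` is at least `2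
  -- * c * t ^ 2`. The second serves larger `α`, where `ρ ≤ α` suffices because `c * t ≤ 1 / 2`.
  refine ⟨min (Real.log 2 / (8 * l ^ 2)) (1 / (2 * l)), by positivity, fun α hα hα2 => ?_⟩
  set c := min (Real.log 2 / (8 * l ^ 2)) (1 / (2 * l)) with hc
  have hα1 : α < 1 := by linarith
  have hgr := PatternAP.isGreatest_rho (a := a)
    ⟨α, fun ρ hρ => PatternAP.le_of_mem_lowerBounds_of_lt_one hk hα hα1 hρ⟩
  refine ⟨hgr, ?_⟩
  set t := Real.log (1 / α) with ht
  have hlogα : Real.log α = -t := by rw [ht, one_div, Real.log_inv, neg_neg]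
  have ht0 : 0 < t := Real.log_pos ((one_lt_div hα).2 hα1)
  have hrhs : α ^ (c * t) = Real.exp (-(c * t ^ 2)) := by
    rw [Real.rpow_def_of_pos hα, hlogα]
    congr 1
    ring
  rw [hrhs]
  rcases lt_or_ge t l with htl | htl
  · refine (PatternAP.le_of_mem_lowerBounds_of_lt_one hk hα hα1 hgr.1).trans_lt ?_
    rw [← Real.exp_log hα, hlogα, Real.exp_lt_exp, neg_lt_neg_iff]
    have h3 : c * t ≤ 1 / (2 * l) * l := by
      gcongr
      exact min_le_right _ _
    have h4 : 1 / (2 * l) * l = 1 / 2 := by field_simp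
    nlinarith
  · set r := ⌊t / l⌋₊ with hr
    have hr0 : 0 < r := Nat.floor_pos.2 ((one_le_div hl0).2 htl)
    have hrle : (r : ℝ) * l ≤ t := (le_div_iff₀ hl0).1 (Nat.floor_le (by positivity))
    have hrge : t / l ≤ 2 * r := by
      have h3 := Nat.lt_floor_add_one (t / l)
      have h4 : (1 : ℝ) ≤ r := by exact_mod_cast hr0
      rw [← hr] at h3
      linarith
    have hαD : α * (D : ℝ) ^ r ≤ 1 := by
      rw [← Real.exp_log hα, ← Real.exp_log (show (0 : ℝ) < (D : ℝ) ^ r by positivity),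
        ← Real.exp_add, Real.exp_le_one_iff, Real.log_pow, hlogα, ← hl]
      linarith
    refine (hbound r hr0 α hα hα1 hαD _ hgr.1).trans_lt ?_
    rw [one_div, ← pow_mul, ← Real.exp_log (show (0 : ℝ) < 2 ^ (r * r) by positivity),
      ← Real.exp_neg, Real.exp_lt_exp, neg_lt_neg_iff, Real.log_pow]
    push_cast
    have h3 : t ≤ 2 * r * l := (div_le_iff₀ hl0).1 hrge
    calc c * t ^ 2 ≤ Real.log 2 / (8 * l ^ 2) * (2 * r * l) ^ 2 := by
          gcongr
          exact min_le_left _ _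
      _ = r * r * Real.log 2 / 2 := by field_simp; ring
      _ < r * r * Real.log 2 := by
          have : 0 < (r : ℝ) * r * Real.log 2 := by positivity
          linarith
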